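/- Let $\pi:\mathcal E\to M$ be a smooth fibered manifold (a surjective smooth submersion of finite-dimensional, Hausdorff, second countable smooth manifolds), let $J^k(\mathcal E)$ be the manifold of $k$-jets of local sections of $\pi$ ($k\ge 0$), and let $\mathcal H^k\subset J^k(\mathcal E)$ be a nonlinear PDE of order $k$, i.e. a (smoothly embedded) submanifold for which $\mathcal H^k\to M$ is again a fibered manifold. Let $\varepsilon$ be a smooth section of $J^{k+1}(\mathcal E)|_{\mathcal H^k}\to\mathcal H^k$, let $\varepsilon(\mathcal H^k)\subset J^{k+1}(\mathcal E)$ be its image (a prehomogeneous geometry of order $k+1$), and let $$\varrho(\varepsilon(\mathcal H^k)) = J^1(\varepsilon(\mathcal H^k))\cap J^{k+2}(\mathcal E)\subset J^1(J^{k+1}(\mathcal E))$$ be its prolongation, where $J^1(\varepsilon(\mathcal H^k))$ is the set of $1$-jets of local sections of $\varepsilon(\mathcal H^k)\to M$ and $J^{k+2}(\mathcal E)$ is embedded in $J^1(J^{k+1}(\mathcal E))$ by $j^{k+2}_p s\mapsto j^1_p(j^{k+1}s)$. (i) The PDE $\varepsilon(\mathcal H^k)$ has unique holonomic local solutions for arbitrary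 initial conditions if and only if the jet projection $\pi^{k+2}_{k+1}:\varrho(\varepsilon(\mathcal H^k))\to\varepsilon(\mathcal H^k)$ is surjective. Here the first property means: for every $r\in\varepsilon(\mathcal H^k)$ over $p\in M$ there is a smooth local section $s$ of $\pi$ defined near $p$ with $j^{k+1}_p s=r$ and $j^{k+1}_x s\in\varepsilon(\mathcal H^k)$ for all $x$ in its domain, and any two such $s$ agree on a neighbourhood of $p$. (ii) There exist a smooth real vector bundle $F_1$ of finite rank over $\varepsilon(\mathcal H^k)\simeq\mathcal H^k$ and a smooth section $\mathcal R$ of $F_1$ such that $$\varrho(\varepsilon(\mathcal H^k))\xrightarrow{\ \pi^{k+2}_{k+1}\ }\varepsilon(\mathcal H^k)\xrightarrow{\ \mathcal R\ }F_1$$ is exact at the middle term, i.e. the image of $\pi^{k+2}_{k+1}$ is the zero set of $\mathcal R$. Consequently $\mathcal R=0$ if and only if $\varrho(\varepsilon(\mathcal H^k))\to\varepsilon(\mathcal H^k)$ is surjective. -/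

import Mathlib

open scoped Manifold ContDiff Topology

noncomputable section

namespace JetGeometry

/-- `π : E → M` is a smooth fibered manifold: a surjective smooth submersion. Here `M` is modelled
on `X` and `E` on `W`. -/
structure IsFibered (X W : Type*) [NormedAddCommGroup X] [NormedSpace ℝ X]
    [NormedAddCommGroup W] [NormedSpace ℝ W]
    {M E : Type*} [TopologicalSpace M] [ChartedSpace X M] [TopologicalSpace E] [ChartedSpace W E]
    (π : E → M) : Prop where
  submersion : Manifold.IsSubmersion 𝓘(ℝ, W) 𝓘(ℝ, X) ∞ π
  surjective : Function.Surjective π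

/-- A smooth local section of `π : E → M`, defined on the open set `domain` (the values of `toFun`
outside `domain` are irrelevant). -/
structure LocalSection (X W : Type*) [NormedAddCommGroup X] [NormedSpace ℝ X]
    [NormedAddCommGroup W] [NormedSpace ℝ W]
    {M E : Type*} [TopologicalSpace M] [ChartedSpace X M] [TopologicalSpace E] [ChartedSpace W E]
    (π : E → M) where
  domain : Set M
  isOpen_domain : IsOpen domain
  toFun : M → E
  contMDiffOn : ContMDiffOn 𝓘(ℝ, X) 𝓘(ℝ, W) ∞ toFun domain
  proj_apply : ∀ p ∈ domain, π (toFun p) = p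

/-- Fibered coordinates on an open subset of `E`: a smooth chart `total` of `E` and a smooth chart
`base` of `M` in which `π` reads `(x, y) ↦ x`. -/
structure FiberedChart (X Y : Type*) [NormedAddCommGroup X] [NormedSpace ℝ X]
    [NormedAddCommGroup Y] [NormedSpace ℝ Y]
    {M E : Type*} [TopologicalSpace M] [ChartedSpace X M]
    [TopologicalSpace E] [ChartedSpace (X × Y) E] (π : E → M) where
  total : OpenPartialHomeomorph E (X × Y)
  base : OpenPartialHomeomorph M X
  total_mem : total ∈ IsManifold.maximalAtlas 𝓘(ℝ, X × Y) ∞ E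
  base_mem : base ∈ IsManifold.maximalAtlas 𝓘(ℝ, X) ∞ M
  mapsTo : ∀ q ∈ total.source, π q ∈ base.source
  fst_apply : ∀ q ∈ total.source, (total q).1 = base (π q)

/-- The space of the jet coordinates `(x, y, y₁, …, y_k)`, where `y_j` is a `j`-linear map
`X × ⋯ × X → Y`, the `j`-th derivative. (The coordinates of an actual jet are symmetric.) -/
abbrev JetCoord (X Y : Type*) [NormedAddCommGroup X] [NormedSpace ℝ X]
    [NormedAddCommGroup Y] [NormedSpace ℝ Y] (k : ℕ) : Type _ :=
  X × ((j : Fin (k + 1)) → (X [×(j : ℕ)]→L[ℝ] Y))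

section

variable {X Y : Type*} [NormedAddCommGroup X] [NormedSpace ℝ X]
  [NormedAddCommGroup Y] [NormedSpace ℝ Y]
  {M E : Type*} [TopologicalSpace M] [ChartedSpace X M]
  [TopologicalSpace E] [ChartedSpace (X × Y) E] {π : E → M}

/-- The local section `s` written in fibered coordinates, `x ↦ y(x)`. -/
def LocalSection.rep (s : LocalSection X (X × Y) π) (c : FiberedChart X Y π) : X → Y :=
  fun x => (c.total (s.toFun (c.base.symm x))).2

/-- The prolonged section `x ↦ (x, y(x), Dy(x), …, D^k y(x))` in fibered coordinates. -/
def LocalSection.prolongRep (s : LocalSection X (X × Y) π) (c : FiberedChart X Y π) (k : ℕ) :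
    X → JetCoord X Y k :=
  fun x => (x, fun j => iteratedFDeriv ℝ (j : ℕ) (s.rep c) x)

end

section

variable (X Y : Type*) [NormedAddCommGroup X] [NormedSpace ℝ X]
  [NormedAddCommGroup Y] [NormedSpace ℝ Y]
  {M E : Type*} [TopologicalSpace M] [ChartedSpace X M]
  [TopologicalSpace E] [ChartedSpace (X × Y) E] (π : E → M)

/-- A local section together with a point of its domain. -/
abbrev PointedSection : Type _ := Σ s : LocalSection X (X × Y) π, s.domain

/-- Two local sections have the same `k`-jet at a point: same value, and the same derivatives up to
order `k` in fibered coordinates. -/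
def jetSetoid (k : ℕ) : Setoid (PointedSection X Y π) where
  r a b := (a.2 : M) = b.2 ∧ a.1.toFun a.2 = b.1.toFun b.2 ∧
    ∀ c : FiberedChart X Y π, a.1.toFun a.2 ∈ c.total.source →
      a.1.prolongRep c k (c.base a.2) = b.1.prolongRep c k (c.base b.2)
  iseqv :=
    { refl := fun _ => ⟨rfl, rfl, fun _ _ => rfl⟩
      symm := fun h => ⟨h.1.symm, h.2.1.symm, fun c hc => (h.2.2 c (by rw [h.2.1]; exact hc)).symm⟩
      trans := fun h h' => ⟨h.1.trans h'.1, h.2.1.trans h'.2.1, fun c hc =>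
        (h.2.2 c hc).trans (h'.2.2 c (by rw [← h.2.1]; exact hc))⟩ }

/-- The space `J^k(E)` of `k`-jets of local sections of `π : E → M`. -/
def Jet (k : ℕ) : Type _ := Quotient (jetSetoid X Y π k)

end

section

variable {X Y : Type*} [NormedAddCommGroup X] [NormedSpace ℝ X]
  [NormedAddCommGroup Y] [NormedSpace ℝ Y]
  {M E : Type*} [TopologicalSpace M] [ChartedSpace X M]
  [TopologicalSpace E] [ChartedSpace (X × Y) E] {π : E → M}

/-- The `k`-jet `j^k_p s` of the local section `s` at a point `p` of its domain. -/
def LocalSection.jet (s : LocalSection X (X × Y) π) (k : ℕ) (p : M) (hp : p ∈ s.domain) :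
    Jet X Y π k :=
  Quotient.mk (jetSetoid X Y π k) ⟨s, ⟨p, hp⟩⟩

namespace Jet

/-- The projection `J^k(E) → M`. -/
def base {k : ℕ} : Jet X Y π k → M :=
  Quotient.lift (fun a => (a.2 : M)) (fun _ _ h => h.1)

/-- The projection `J^k(E) → E`. -/
def target {k : ℕ} : Jet X Y π k → E :=
  Quotient.lift (fun a => a.1.toFun a.2) (fun _ _ h => h.2.1)

/-- The projection `J^{k+1}(E) → J^k(E)`. -/
def proj {k : ℕ} : Jet X Y π (k + 1) → Jet X Y π k :=
  Quotient.map' id (fun _ _ h => ⟨h.1, h.2.1, fun c hc => by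
    have h3 := h.2.2 c hc
    have h1 := congrArg Prod.fst h3
    have h2 := congrArg Prod.snd h3
    refine Prod.ext h1 (funext fun j => ?_)
    exact congrFun h2 j.castSucc⟩)

open Classical in
/-- The coordinates of a `k`-jet in fibered coordinates (with the value `0` at the jets that do not
lie over the domain of the chart). -/
def coord {k : ℕ} (c : FiberedChart X Y π) : Jet X Y π k → JetCoord X Y k :=
  Quotient.lift
    (fun a => if a.1.toFun a.2 ∈ c.total.source then a.1.prolongRep c k (c.base a.2) else 0)
    (fun a b h => by
      by_cases hc : a.1.toFun a.2 ∈ c.total.source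
      · have hc' : b.1.toFun b.2 ∈ c.total.source := by rw [← h.2.1]; exact hc
        simp only [hc, hc', if_true]
        exact h.2.2 c hc
      · have hc' : ¬ b.1.toFun b.2 ∈ c.total.source := by rw [← h.2.1]; exact hc
        simp only [hc, hc', if_false])

/-- The manifold topology of `J^k(E)`, for which the jet coordinates associated with the fibered
charts of `E` are homeomorphisms onto their images. -/
instance instTopologicalSpace {k : ℕ} : TopologicalSpace (Jet X Y π k) :=
  TopologicalSpace.generateFrom
    {S | ∃ (c : FiberedChart X Y π) (O : Set (JetCoord X Y k)), IsOpen O ∧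
      S = {z | z.target ∈ c.total.source ∧ coord c z ∈ O}}

end Jet

section

variable {Z N : Type*} [NormedAddCommGroup Z] [NormedSpace ℝ Z]
  [TopologicalSpace N] [ChartedSpace Z N]

/-- A map from a manifold to `J^k(E)` is smooth: it is continuous and smooth in jet coordinates. -/
def IsSmoothToJet (Z : Type*) [NormedAddCommGroup Z] [NormedSpace ℝ Z]
    {N : Type*} [TopologicalSpace N] [ChartedSpace Z N] {k : ℕ} (f : N → Jet X Y π k) : Prop :=
  Continuous f ∧ ∀ c : FiberedChart X Y π,
    ContMDiffOn 𝓘(ℝ, Z) 𝓘(ℝ, JetCoord X Y k) ∞ (fun z => Jet.coord c (f z))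
      {z | (f z).target ∈ c.total.source}

/-- A map from a manifold to `J^k(E)` is an immersion: it is smooth, and its differential in jet
coordinates is injective at every point. -/
def IsImmersionToJet (Z : Type*) [NormedAddCommGroup Z] [NormedSpace ℝ Z]
    {N : Type*} [TopologicalSpace N] [ChartedSpace Z N] {k : ℕ} (f : N → Jet X Y π k) : Prop :=
  IsSmoothToJet Z f ∧ ∀ (c : FiberedChart X Y π) (z : N), (f z).target ∈ c.total.source →
    Function.Injective
      (mfderiv 𝓘(ℝ, Z) 𝓘(ℝ, JetCoord X Y k) (fun z => Jet.coord c (f z)) z)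

end

/-- A nonlinear PDE of order `k` on `π : E → M`: a fibered submanifold `H ⊆ J^k(E)`. That is, the
subspace `H` of `J^k(E)` carries a smooth manifold structure (the instance arguments) for which the
inclusion is an immersion, and `H → M` is a fibered manifold. -/
structure IsPDE (Z : Type*) [NormedAddCommGroup Z] [NormedSpace ℝ Z] {k : ℕ}
    (H : Set (Jet X Y π k)) [ChartedSpace Z H] : Prop where
  immersion : IsImmersionToJet Z (fun h : H => (h : Jet X Y π k))
  fibered : IsFibered X Z (fun h : H => (h : Jet X Y π k).base)

/-- A smooth section `ε` of `J^{k+1}(E)|_H → H`. Its image `ε(H) ⊆ J^{k+1}(E)` is a prehomogeneous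
geometry of order `k + 1`. -/
structure IsJetSection (Z : Type*) [NormedAddCommGroup Z] [NormedSpace ℝ Z] {k : ℕ}
    {H : Set (Jet X Y π k)} [ChartedSpace Z H] (ε : H → Jet X Y π (k + 1)) : Prop where
  smooth : IsSmoothToJet Z ε
  proj_apply : ∀ h : H, (ε h).proj = h

/-- The local section `s` of `E` is a solution of the PDE `K ⊆ J^l(E)`: its `l`-jets lie
in `K`. (Equivalently, `j^l s` is a holonomic local section of `K → M`.) -/
def LocalSection.IsSolution (s : LocalSection X (X × Y) π) {l : ℕ} (K : Set (Jet X Y π l)) :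
    Prop :=
  ∀ (p : M) (hp : p ∈ s.domain), s.jet l p hp ∈ K

/-- The PDE `K ⊆ J^l(E)` has unique holonomic local solutions for arbitrary initial conditions:
through every `r ∈ K` over `p ∈ M` there passes a local solution, and any two such solutions agree
near `p`. -/
def HasUniqueLocalSolutions {l : ℕ} (K : Set (Jet X Y π l)) : Prop :=
  ∀ r ∈ K,
    (∃ (s : LocalSection X (X × Y) π) (hs : r.base ∈ s.domain),
      s.IsSolution K ∧ s.jet l r.base hs = r) ∧
    ∀ (s t : LocalSection X (X × Y) π) (hs : r.base ∈ s.domain) (ht : r.base ∈ t.domain),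
      s.IsSolution K → t.IsSolution K → s.jet l r.base hs = r → t.jet l r.base ht = r →
        s.toFun =ᶠ[𝓝 r.base] t.toFun

/-- The sections `j^l s` and `f` of `J^l(E) → M` have the same `1`-jet at `p`: the same value and,
in jet coordinates, the same first derivative. -/
def SameOneJet (s : LocalSection X (X × Y) π) {l : ℕ} (f : M → Jet X Y π l) (p : M)
    (hp : p ∈ s.domain) : Prop :=
  s.jet l p hp = f p ∧ ∀ c : FiberedChart X Y π, s.toFun p ∈ c.total.source →
    fderiv ℝ (s.prolongRep c l) (c.base p) =
      fderiv ℝ (fun x => Jet.coord c (f (c.base.symm x))) (c.base p)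

/-- The prolongation `ϱ(ε(H)) = J^1(ε(H)) ∩ J^{k+2}(E)`, the intersection being taken in
`J^1(J^{k+1}(E))`: those `(k+2)`-jets `j^{k+2}_p s` whose image `j^1_p(j^{k+1} s)` under the
canonical inclusion `J^{k+2}(E) ⊆ J^1(J^{k+1}(E))` is the `1`-jet at `p` of a local section of
`ε(H) → M`. The local sections of `ε(H) → M` are the `ε ∘ σ`, with `σ` a local section of
`H → M`. -/
def prolongation (Z : Type*) [NormedAddCommGroup Z] [NormedSpace ℝ Z] {k : ℕ}
    {H : Set (Jet X Y π k)} [ChartedSpace Z H] (ε : H → Jet X Y π (k + 1)) :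
    Set (Jet X Y π (k + 2)) :=
  {z | ∃ (s : LocalSection X (X × Y) π) (p : M) (hp : p ∈ s.domain),
    z = s.jet (k + 2) p hp ∧
      ∃ σ : LocalSection X Z (fun h : H => (h : Jet X Y π k).base),
        p ∈ σ.domain ∧ SameOneJet s (fun q => ε (σ.toFun q)) p hp}

end

end JetGeometry

end

/-! In jet coordinates a (k+1)-jet determines a horizontal plane v ↦ (v, y₁(v), …, y_{k+1}(v)) in
the space of k-jet coordinates (`JetCoord.totalDeriv`). Applied to the jets of ε and projected to H
by an adapted chart, this gives a field A of n-planes on H (`AdaptedChart.slope`), n = dim M. If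
j^{k+1}s = ε ∘ σ, comparing first derivatives shows that σ solves the total differential equation Dσ
= A ∘ σ (`SameOneJet.hasFDerivAt_rep`). Since A is smooth, a solution is determined by its value at
one point. Uniqueness therefore holds for every ε, and only existence is at stake.

The jet ε(h) can be prolonged exactly when Dε ∘ A at h is the horizontal plane of symmetric
(k+2)-jet coordinates over ε(h) (`mem_image_iff_isHolonomicPlane`). If this holds at every h,
symmetry of the top derivatives makes second total derivatives commute, and this is Frobenius'
integrability condition for A (`AdaptedChart.fderiv_slope_symm`). The resulting integral map σ makes
f = ε ∘ σ tangent to the planes given by its own coordinates, so f is the (k+1)-jet of its component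
of order zero, which is the required solution (`exists_solution_of_surjOn`). Conversely, the
(k+2)-jet of a solution lies in the prolongation.

For the curvature, being such a plane is written as the vanishing of a smooth vector-valued function
(`holonomyDefect`). One component says that the plane of ε(h) is tangent to H, the other that the
top components of Dε ∘ A are symmetric. The zero set of this function is intrinsic although the
function depends on coordinates. Composing with a smooth nonnegative function that vanishes only at
0 and gluing by a partition of unity gives a global function with the right zero set
(`exists_curvature`), so the trivial line bundle serves as F₁. -/

noncomputable section

namespace JetGeometry

set_option linter.unusedSectionVars false

/-! ### Total differential equations Dσ = A ∘ σ: existence, uniqueness, smoothness. -/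

section Frobenius

open Set Metric Filter
open scoped NNReal

variable {X Z : Type*} [NormedAddCommGroup X] [NormedSpace ℝ X]
  [NormedAddCommGroup Z] [NormedSpace ℝ Z]

/-- Picard–Lindelöf for an autonomous Lipschitz vector field on a ball, on the time interval
`[0, 1]`, with the information that the solution does not leave the ball. -/
theorem exists_integralCurve_mem_closedBall [CompleteSpace Z] {f : Z → Z} {z₀ : Z} {a : ℝ≥0}
    {K : ℝ≥0} (hK : LipschitzOnWith K f (closedBall z₀ a))
    (hL : ∀ z ∈ closedBall z₀ a, ‖f z‖ ≤ a) :
    ∃ α : ℝ → Z, α 0 = z₀ ∧ (∀ t, α t ∈ closedBall z₀ a) ∧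
      ∀ t ∈ Icc (0 : ℝ) 1, HasDerivWithinAt α (f (α t)) (Icc 0 1) t := by
  -- Initial radius 0 and speed at most `a`: in unit time the curve moves by at most `a`. The fixed
  -- point of the Picard operator is kept explicitly because membership in its function space gives
  -- the confinement to the ball.
  have hpl : IsPicardLindelof (fun _ => f) (⟨0, by simp⟩ : Icc (0 : ℝ) 1) z₀ a 0 a K :=
    { lipschitzOnWith := fun t _ => hK
      continuousOn := fun x _ => continuousOn_const
      norm_le := fun t _ x hx => hL x hx
      mul_max_le := by simp }
  have hx : z₀ ∈ closedBall z₀ ((0 : ℝ≥0) : ℝ) := by simp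
  obtain ⟨α, hα⟩ := ODE.FunSpace.exists_isFixedPt_next hpl hx
  refine ⟨α.compProj, ?_, fun t => α.compProj_mem_closedBall hpl.mul_max_le, fun t ht => ?_⟩
  · have : α.compProj (⟨0, by simp⟩ : Icc (0 : ℝ) 1) = z₀ := by
      rw [ODE.FunSpace.compProj_val, ← hα, ODE.FunSpace.next_apply₀]
    exact this
  · apply ODE.hasDerivWithinAt_picard_Icc (⟨0, by simp⟩ : Icc (0 : ℝ) 1).2
      hpl.continuousOn_uncurry
      α.continuous_compProj.continuousOn (fun _ ht' ↦ α.compProj_mem_closedBall hpl.mul_max_le)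
      z₀ ht |>.congr_of_mem _ ht
    intro t' ht'
    nth_rw 1 [← hα]
    rw [ODE.FunSpace.compProj_of_mem ht', ODE.FunSpace.next_apply]

theorem gronwallBound_zero_eq_mul {K ε : ℝ} (hK : K ≠ 0) (x : ℝ) :
    gronwallBound 0 K ε x = ε * ((Real.exp (K * x) - 1) / K) := by
  rw [gronwallBound_of_K_ne_0 hK]; ring

/-- Second order Taylor estimate on a convex set where the derivative is Lipschitz. -/
theorem norm_sub_sub_fderiv_le {V W : Type*} [NormedAddCommGroup V] [NormedSpace ℝ V]
    [NormedAddCommGroup W] [NormedSpace ℝ W] {f : V → W} {s : Set V} (hs : Convex ℝ s)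
    (hf : ∀ z ∈ s, DifferentiableAt ℝ f z) {C : ℝ≥0} (hC : LipschitzOnWith C (fderiv ℝ f) s)
    {z z' : V} (hz : z ∈ s) (hz' : z' ∈ s) :
    ‖f z' - f z - fderiv ℝ f z (z' - z)‖ ≤ C * ‖z' - z‖ ^ 2 := by
  have hseg : segment ℝ z z' ⊆ s := hs.segment_subset hz hz'
  have := (convex_segment z z').norm_image_sub_le_of_norm_hasFDerivWithin_le'
    (f := f) (f' := fun y => fderiv ℝ f y) (φ := fderiv ℝ f z) (C := C * ‖z' - z‖)
    (fun y hy => (hf y (hseg hy)).hasFDerivAt.hasFDerivWithinAt)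
    (fun y hy => by
      refine (hC.norm_sub_le (hseg hy) hz).trans ?_
      gcongr
      rw [← dist_eq_norm, ← dist_eq_norm, dist_comm y z, dist_comm z' z]
      have := dist_add_dist_of_mem_segment hy
      have h2 := dist_nonneg (x := y) (y := z')
      linarith)
    (left_mem_segment ℝ z z') (right_mem_segment ℝ z z')
  calc _ ≤ C * ‖z' - z‖ * ‖z' - z‖ := this
    _ = _ := by ring

/-- Local constants controlling a smooth field of linear maps. -/
theorem exists_closedBall_bounds {V W : Type*} [NormedAddCommGroup V] [NormedSpace ℝ V]
    [NormedAddCommGroup W] [NormedSpace ℝ W] {f : V → W} {O : Set V} {z₀ : V}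
    (hO : IsOpen O) (hz₀ : z₀ ∈ O) (hf : ContDiffOn ℝ ∞ f O) :
    ∃ (a : ℝ≥0) (K M C : ℝ≥0), 0 < a ∧ 1 ≤ K ∧ closedBall z₀ a ⊆ O ∧
      LipschitzOnWith K f (closedBall z₀ a) ∧ LipschitzOnWith C (fderiv ℝ f) (closedBall z₀ a) ∧
      (∀ z ∈ closedBall z₀ a, ‖f z‖ ≤ M) ∧ (∀ z ∈ closedBall z₀ a, ‖fderiv ℝ f z‖ ≤ M) := by
  have hfat : ContDiffAt ℝ ∞ f z₀ := hf.contDiffAt (hO.mem_nhds hz₀)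
  have hfd : ContDiffAt ℝ ∞ (fderiv ℝ f) z₀ := hfat.fderiv_right (by simp)
  obtain ⟨K, t, ht, hK⟩ := (hfat.of_le (m := 1) (by norm_cast)).exists_lipschitzOnWith
  obtain ⟨C, t', ht', hC⟩ :=
    (hfd.of_le (m := 1) (by norm_cast)).exists_lipschitzOnWith
  have h1 : ∀ᶠ z in 𝓝 z₀, ‖f z‖ < ‖f z₀‖ + 1 :=
    hfat.continuousAt.norm.eventually_lt continuousAt_const (by simp)
  have h2 : ∀ᶠ z in 𝓝 z₀, ‖fderiv ℝ f z‖ < ‖fderiv ℝ f z₀‖ + 1 :=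
    hfd.continuousAt.norm.eventually_lt continuousAt_const (by simp)
  have hall : ∀ᶠ z in 𝓝 z₀, z ∈ O ∧ z ∈ t ∧ z ∈ t' ∧ ‖f z‖ < ‖f z₀‖ + 1 ∧
      ‖fderiv ℝ f z‖ < ‖fderiv ℝ f z₀‖ + 1 := by
    filter_upwards [hO.mem_nhds hz₀, ht, ht', h1, h2] with z a b c d e using ⟨a, b, c, d, e⟩
  obtain ⟨r, hr, hball⟩ := Metric.nhds_basis_closedBall.mem_iff.1 hall
  -- The Lipschitz constant is raised to at least 1 because the Gronwall bound is later used in its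
  -- form for a nonzero constant.
  refine ⟨⟨r, hr.le⟩, max K 1, ⟨max (‖f z₀‖ + 1) (‖fderiv ℝ f z₀‖ + 1), by positivity⟩, C, hr,
    le_max_right _ _, fun z hz => (hball hz).1,
    (hK.mono fun z hz => (hball hz).2.1).weaken (le_max_left _ _),
    hC.mono fun z hz => (hball hz).2.2.1,
    fun z hz => (hball hz).2.2.2.1.le.trans (le_max_left _ _),
    fun z hz => (hball hz).2.2.2.2.le.trans (le_max_right _ _)⟩

/-- **Frobenius theorem** for the autonomous total differential equation `Dσ = A ∘ σ`: if the
derivative of `A` along `A` is symmetric, there is a solution through every point. -/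
theorem exists_hasFDerivAt_of_involutive [CompleteSpace Z] {A : Z → X →L[ℝ] Z} {O : Set Z}
    (hO : IsOpen O) (hA : ContDiffOn ℝ ∞ A O)
    (hsymm : ∀ z ∈ O, ∀ v w, fderiv ℝ A z (A z v) w = fderiv ℝ A z (A z w) v)
    (x₀ : X) {z₀ : Z} (hz₀ : z₀ ∈ O) :
    ∃ r > 0, ∃ σ : X → Z, σ x₀ = z₀ ∧ ∀ x ∈ ball x₀ r, σ x ∈ O ∧ HasFDerivAt σ (A (σ x)) x := by
  obtain ⟨a, K, M, C, ha, hK1, haO, hK, hC, hM, hM'⟩ := exists_closedBall_bounds hO hz₀ hA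
  have hdiff : ∀ z ∈ closedBall z₀ a, DifferentiableAt ℝ A z := fun z hz =>
    (hA.contDiffAt (hO.mem_nhds (haO hz))).differentiableAt (by simp)
  -- Half of the radius `a` is for the curves, which move by at most `M * r`; the other half absorbs
  -- the perturbation `w` below. The bound `r ≤ 1` lets `K` be a Lipschitz constant of `z ↦ A z x`.
  obtain ⟨r, hr, hr1, hrM⟩ : ∃ r : ℝ, 0 < r ∧ r ≤ 1 ∧ M * r ≤ a / 2 := by
    refine ⟨min 1 (a / 2 / (M + 1)), by positivity, min_le_left _ _, ?_⟩
    calc (M : ℝ) * min 1 (a / 2 / (M + 1)) ≤ (M + 1) * (a / 2 / (M + 1)) := by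
          gcongr
          · simp
          · exact min_le_right _ _
      _ = a / 2 := by field_simp
  have hhalf : closedBall z₀ ((a / 2 : ℝ≥0) : ℝ) ⊆ closedBall z₀ a :=
    closedBall_subset_closedBall (by push_cast; linarith [a.2])
  -- `α x` is what a solution must be along the ray from `x₀` in direction `x`; its value at time 1
  -- is the candidate for the solution at `x₀ + x`.
  have hsol : ∀ x : X, ‖x‖ ≤ r → ∃ α : ℝ → Z, α 0 = z₀ ∧
      (∀ t, α t ∈ closedBall z₀ ((a / 2 : ℝ≥0) : ℝ)) ∧
      ∀ t ∈ Icc (0 : ℝ) 1, HasDerivWithinAt α (A (α t) x) (Icc 0 1) t := by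
    intro x hx
    refine exists_integralCurve_mem_closedBall (f := fun z => A z x) (K := K) ?_ ?_
    · refine LipschitzOnWith.of_dist_le_mul fun z hz z' hz' => ?_
      rw [dist_eq_norm, ← sub_apply]
      calc ‖(A z - A z') x‖ ≤ ‖A z - A z'‖ * ‖x‖ := ContinuousLinearMap.le_opNorm _ _
        _ ≤ (K * dist z z') * 1 := by
          gcongr
          · rw [← dist_eq_norm]; exact hK.dist_le_mul _ (hhalf hz) _ (hhalf hz')
          · linarith
        _ = _ := mul_one _
    · intro z hz
      calc ‖A z x‖ ≤ ‖A z‖ * ‖x‖ := ContinuousLinearMap.le_opNorm _ _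
        _ ≤ M * r := by gcongr; exact hM z (hhalf hz)
        _ ≤ _ := by push_cast; exact hrM
  choose! α hα0 hαmem hα using hsol
  have hright : ∀ {f : ℝ → Z} {f' : Z} {t : ℝ}, t ∈ Ico (0 : ℝ) 1 →
      HasDerivWithinAt f f' (Icc 0 1) t → HasDerivWithinAt f f' (Ici t) t := by
    intro f f' t ht h
    exact h.mono_of_mem_nhdsWithin (Icc_mem_nhdsGE_of_mem ht)
  set c : ℝ := (Real.exp K - 1) / K with hc
  have hc0 : 0 ≤ c := by
    have : (0 : ℝ) ≤ K := K.2
    have h2 : 1 ≤ Real.exp K := Real.one_le_exp this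
    exact div_nonneg (by linarith) this
  have key : ∀ x h : X, ‖x‖ < r → ‖x + h‖ < r → M * ‖h‖ ≤ a / 2 →
      ‖α (x + h) 1 - α x 1 - A (α x 1) h‖ ≤ (M * M + C * M * M) * c * ‖h‖ ^ 2 := by
    intro x h hx hxh hh
    have hAh : ∀ t, ‖A (α x t) h‖ ≤ M * ‖h‖ := fun t =>
      (ContinuousLinearMap.le_opNorm _ _).trans (by gcongr; exact hM _ (hhalf (hαmem x hx.le t)))
    -- First-order guess for `α (x + h)`. Differentiable dependence on parameters is not needed: `w`
    -- solves the equation of `α (x + h)` up to an error quadratic in `h`, and Gronwall's inequality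
    -- compares the two curves.
    set w : ℝ → Z := fun t => α x t + t • A (α x t) h with hw
    set w' : ℝ → Z := fun t => A (α x t) x + (A (α x t) h + t • fderiv ℝ A (α x t) (A (α x t) x) h)
      with hw'
    have hwd : ∀ t ∈ Icc (0 : ℝ) 1, HasDerivWithinAt w (w' t) (Icc 0 1) t := by
      intro t ht
      have h1 := hα x hx.le t ht
      have h2 : HasDerivWithinAt (fun t => A (α x t)) (fderiv ℝ A (α x t) (A (α x t) x))
          (Icc 0 1) t :=
        (hdiff _ (hhalf (hαmem x hx.le t))).hasFDerivAt.comp_hasDerivWithinAt t h1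
      have h3 : HasDerivWithinAt (fun t => A (α x t) h) (fderiv ℝ A (α x t) (A (α x t) x) h)
          (Icc 0 1) t := by
        simpa using h2.clm_apply (hasDerivWithinAt_const t _ h)
      have h4 := h1.add ((hasDerivWithinAt_id t (Icc (0 : ℝ) 1)).smul h3)
      convert! h4 using 1
      simp [hw', add_comm]
    have hwmem : ∀ t ∈ Icc (0 : ℝ) 1, w t ∈ closedBall z₀ (a : ℝ) := by
      intro t ht
      rw [mem_closedBall, dist_eq_norm]
      have h1 := hαmem x hx.le t
      rw [mem_closedBall, dist_eq_norm] at h1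
      push_cast at h1
      calc ‖w t - z₀‖ = ‖(α x t - z₀) + t • A (α x t) h‖ := by simp only [hw]; congr 1; abel
        _ ≤ ‖α x t - z₀‖ + ‖t • A (α x t) h‖ := norm_add_le _ _
        _ ≤ a / 2 + a / 2 := by
          gcongr
          rw [norm_smul, Real.norm_of_nonneg ht.1]
          calc t * ‖A (α x t) h‖ ≤ 1 * (M * ‖h‖) := by gcongr; exacts [ht.2, hAh t]
            _ ≤ a / 2 := by rw [one_mul]; exact hh
        _ = a := by ring
    have hbound : ∀ t ∈ Ico (0 : ℝ) 1,
        dist (w' t) (A (w t) (x + h)) ≤ (M * M + C * M * M) * ‖h‖ ^ 2 := by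
      intro t ht
      have ht' : t ∈ Icc (0 : ℝ) 1 := ⟨ht.1, ht.2.le⟩
      set z := α x t
      have hz : z ∈ closedBall z₀ (a : ℝ) := hhalf (hαmem x hx.le t)
      have hzO := haO hz
      have hT := norm_sub_sub_fderiv_le (convex_closedBall z₀ (a : ℝ)) hdiff hC hz (hwmem t ht')
      have hwz : w t - z = t • A z h := by simp [hw, z]
      rw [hwz] at hT
      have htA : ‖t • A z h‖ ≤ M * ‖h‖ := by
        rw [norm_smul, Real.norm_of_nonneg ht.1]
        calc t * ‖A z h‖ ≤ 1 * (M * ‖h‖) := by gcongr; exacts [ht.2.le, hAh t]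
          _ = _ := one_mul _
      -- The symmetry hypothesis replaces the term `fderiv ℝ A z (A z x) h` of `w'` by `fderiv ℝ A z
      -- (A z h) x`, which cancels against the Taylor expansion of `A (w t)`. What remains is
      -- quadratic in `h`.
      have e : w' t - A (w t) (x + h) =
          -((A (w t) - A z - fderiv ℝ A z (t • A z h)) (x + h))
            - t • fderiv ℝ A z (A z h) h := by
        simp only [hw', sub_apply, map_add, map_smul,
          smul_apply]
        change A z x + (A z h + t • fderiv ℝ A z (A z x) h) - _ = _
        rw [hsymm z hzO x h]
        abel
      rw [dist_eq_norm, e]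
      calc _ ≤ ‖(A (w t) - A z - fderiv ℝ A z (t • A z h)) (x + h)‖
              + ‖t • fderiv ℝ A z (A z h) h‖ := by
            refine (norm_sub_le _ _).trans ?_
            rw [norm_neg]
        _ ≤ C * (M * ‖h‖) ^ 2 * 1 + 1 * (M * (M * ‖h‖) * ‖h‖) := by
            gcongr
            · refine (ContinuousLinearMap.le_opNorm _ _).trans ?_
              gcongr
              · exact hT.trans (by gcongr)
              · linarith
            · rw [norm_smul, Real.norm_of_nonneg ht.1]
              gcongr
              · exact ht.2.le
              · refine (ContinuousLinearMap.le_opNorm _ _).trans ?_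
                gcongr
                refine (ContinuousLinearMap.le_opNorm _ _).trans ?_
                gcongr
                · exact hM' z hz
                · exact hAh t
        _ = _ := by ring
    have := dist_le_of_approx_trajectories_ODE_of_mem (v := fun _ z => A z (x + h)) (K := K)
      (s := fun _ => closedBall z₀ (a : ℝ)) (a := 0) (b := 1) (f := α (x + h)) (g := w)
      (f' := fun t => A (α (x + h) t) (x + h)) (g' := w') (δ := 0) (εf := 0)
      (εg := (M * M + C * M * M) * ‖h‖ ^ 2)
      (fun t ht => LipschitzOnWith.of_dist_le_mul fun z hz z' hz' => by
        rw [dist_eq_norm, ← sub_apply]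
        calc ‖(A z - A z') (x + h)‖ ≤ ‖A z - A z'‖ * ‖x + h‖ := ContinuousLinearMap.le_opNorm _ _
          _ ≤ (K * dist z z') * 1 := by
            gcongr
            · rw [← dist_eq_norm]; exact hK.dist_le_mul _ hz _ hz'
            · linarith
          _ = _ := mul_one _)
      (fun t ht => (hα (x + h) hxh.le t ht).continuousWithinAt)
      (fun t ht => hright ht (hα (x + h) hxh.le t ⟨ht.1, ht.2.le⟩))
      (fun t ht => by simp)
      (fun t ht => hhalf (hαmem (x + h) hxh.le t))
      (fun t ht => (hwd t ht).continuousWithinAt)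
      (fun t ht => hright ht (hwd t ⟨ht.1, ht.2.le⟩))
      hbound
      (fun t ht => hwmem t ⟨ht.1, ht.2.le⟩)
      (by simp [hw, hα0 _ hx.le, hα0 _ hxh.le]) 1 (by simp)
    rw [zero_add, gronwallBound_zero_eq_mul (by positivity), sub_zero, mul_one, dist_eq_norm] at this
    rw [sub_sub]
    simp only [hw, one_smul] at this
    refine this.trans (le_of_eq ?_)
    rw [← hc]; ring
  -- The vector field for direction 0 vanishes, so this curve is constant.
  have hzero : α 0 1 = z₀ := by
    have h0 : ‖(0 : X)‖ ≤ r := by simpa using hr.le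
    have := constant_of_has_deriv_right_zero (a := 0) (b := 1) (f := α 0)
      (fun t ht => (hα 0 h0 t ht).continuousWithinAt)
      (fun t ht => by simpa using hright ht (hα 0 h0 t ⟨ht.1, ht.2.le⟩)) 1 (by simp)
    rw [this, hα0 0 h0]
  refine ⟨r, hr, fun x => α (x - x₀) 1, by simpa using hzero, fun x hx => ?_⟩
  rw [mem_ball, dist_eq_norm] at hx
  refine ⟨haO (hhalf (hαmem _ hx.le _)), ?_⟩
  rw [hasFDerivAt_iff_isLittleO_nhds_zero]
  have hO2 : (fun h : X => α (x + h - x₀) 1 - α (x - x₀) 1 - A (α (x - x₀) 1) h)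
      =O[𝓝 0] fun h : X => ‖h‖ ^ 2 := by
    refine Asymptotics.IsBigO.of_bound ((M * M + C * M * M) * c) ?_
    have e1 : ∀ᶠ h : X in 𝓝 0, ‖x - x₀ + h‖ < r :=
      ((continuous_const.add continuous_id).norm.continuousAt (x := (0 : X))).eventually_lt
        continuousAt_const (by simpa using hx)
    have e2 : ∀ᶠ h : X in 𝓝 0, M * ‖h‖ < a / 2 :=
      ((continuous_const.mul continuous_norm).continuousAt (x := (0 : X))).eventually_lt
        continuousAt_const (by simpa using ha)
    filter_upwards [e1, e2] with h h1 h2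
    have := key (x - x₀) h hx h1 h2.le
    rw [show x + h - x₀ = x - x₀ + h by abel]
    simpa using this
  exact hO2.trans_isLittleO (Asymptotics.isLittleO_norm_pow_id one_lt_two)

/-- Local uniqueness for `Dσ = A ∘ σ`. -/
theorem eventuallyEq_of_hasFDerivAt {A : Z → X →L[ℝ] Z} {σ τ : X → Z} {x₀ : X}
    (hA : ContDiffAt ℝ 1 A (σ x₀))
    (hσ : ∀ᶠ x in 𝓝 x₀, HasFDerivAt σ (A (σ x)) x)
    (hτ : ∀ᶠ x in 𝓝 x₀, HasFDerivAt τ (A (τ x)) x) (h₀ : σ x₀ = τ x₀) : σ =ᶠ[𝓝 x₀] τ := by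
  obtain ⟨K, t, ht, hK⟩ := hA.exists_lipschitzOnWith
  have h1 := hσ.self_of_nhds.continuousAt.preimage_mem_nhds ht
  have h2 := hτ.self_of_nhds.continuousAt.preimage_mem_nhds (h₀ ▸ ht)
  obtain ⟨r, hr, hball⟩ := Metric.nhds_basis_ball.mem_iff.1
    (inter_mem (inter_mem h1 h2) (inter_mem hσ hτ))
  refine Filter.mem_of_superset (ball_mem_nhds x₀ hr) fun x hx => ?_
  -- Restricted to a segment issuing from `x₀`, both maps solve the same ordinary differential
  -- equation with the same initial value.
  have hpath : ∀ s ∈ Icc (0 : ℝ) 1, x₀ + s • (x - x₀) ∈ ball x₀ r := by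
    intro s hs
    rw [mem_ball, dist_eq_norm, add_sub_cancel_left, norm_smul, Real.norm_of_nonneg hs.1]
    rw [mem_ball, dist_eq_norm] at hx
    nlinarith [norm_nonneg (x - x₀), hs.2]
  have hline : ∀ s : ℝ, HasDerivAt (fun s : ℝ => x₀ + s • (x - x₀)) (x - x₀) s := fun s => by
    simpa using ((hasDerivAt_id s).smul_const (x - x₀)).const_add x₀
  have hd : ∀ {ρ : X → Z}, (∀ y ∈ ball x₀ r, HasFDerivAt ρ (A (ρ y)) y) → ∀ s ∈ Icc (0 : ℝ) 1,
      HasDerivAt (fun s : ℝ => ρ (x₀ + s • (x - x₀))) (A (ρ (x₀ + s • (x - x₀))) (x - x₀)) s :=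
    fun hρ s hs => (hρ _ (hpath s hs)).comp_hasDerivAt s (hline s)
  have hdσ := hd (ρ := σ) fun y hy => (hball hy).2.1
  have hdτ := hd (ρ := τ) fun y hy => (hball hy).2.2
  have := ODE_solution_unique_of_mem_Icc_right (v := fun _ z => A z (x - x₀)) (a := 0) (b := 1)
    (K := K * ‖x - x₀‖₊) (s := fun _ => t)
    (fun s _ => LipschitzOnWith.of_dist_le_mul fun z hz z' hz' => by
        rw [dist_eq_norm, ← sub_apply]
        calc ‖(A z - A z') (x - x₀)‖ ≤ ‖A z - A z'‖ * ‖x - x₀‖ := ContinuousLinearMap.le_opNorm _ _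
          _ ≤ (K * dist z z') * ‖x - x₀‖ := by
            gcongr
            rw [← dist_eq_norm]; exact hK.dist_le_mul _ hz _ hz'
          _ = _ := by push_cast; ring)
    (fun s hs => (hdσ s hs).continuousAt.continuousWithinAt)
    (fun s hs => (hdσ s ⟨hs.1, hs.2.le⟩).hasDerivWithinAt)
    (fun s hs => (hball (hpath s ⟨hs.1, hs.2.le⟩)).1.1)
    (fun s hs => (hdτ s hs).continuousAt.continuousWithinAt)
    (fun s hs => (hdτ s ⟨hs.1, hs.2.le⟩).hasDerivWithinAt)
    (fun s hs => (hball (hpath s ⟨hs.1, hs.2.le⟩)).1.2)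
    (by simpa using h₀)
  simpa using this (right_mem_Icc.2 zero_le_one)

/-- Solutions of `Dσ = A ∘ σ` are smooth. -/
theorem contDiffOn_of_hasFDerivAt {A : Z → X →L[ℝ] Z} {O : Set Z} (hA : ContDiffOn ℝ ∞ A O)
    {σ : X → Z} {U : Set X} (hU : IsOpen U)
    (hσ : ∀ x ∈ U, σ x ∈ O ∧ HasFDerivAt σ (A (σ x)) x) : ContDiffOn ℝ ∞ σ U := by
  rw [contDiffOn_infty]
  intro n
  induction n with
  | zero =>
    exact contDiffOn_zero.2 fun x hx => (hσ x hx).2.continuousAt.continuousWithinAt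
  | succ n ih =>
    push_cast
    rw [contDiffOn_succ_iff_fderiv_of_isOpen hU]
    refine ⟨fun x hx => (hσ x hx).2.differentiableAt.differentiableWithinAt, by simp, ?_⟩
    -- Bootstrap: once σ is n times continuously differentiable, so is its derivative A ∘ σ.
    refine ((hA.of_le (by norm_cast; exact le_top)).comp ih fun x hx => (hσ x hx).1).congr ?_
    exact fun x hx => (hσ x hx).2.fderiv

end Frobenius

/-! ### Symmetry of higher derivatives, Taylor polynomials, agreement to finite order. -/

section Calculus

open Set Filter

variable {X Y W : Type*} [NormedAddCommGroup X] [NormedSpace ℝ X]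
  [NormedAddCommGroup Y] [NormedSpace ℝ Y] [NormedAddCommGroup W] [NormedSpace ℝ W]

/-- Currying the first argument of a continuous multilinear map. -/
def curryFirst (X Y : Type*) [NormedAddCommGroup X] [NormedSpace ℝ X]
    [NormedAddCommGroup Y] [NormedSpace ℝ Y] (n : ℕ) :
    (X [×(n + 1)]→L[ℝ] Y) ≃L[ℝ] (X →L[ℝ] X [×n]→L[ℝ] Y) :=
  (continuousMultilinearCurryLeftEquiv ℝ (fun _ : Fin (n + 1) => X) Y).toContinuousLinearEquiv

theorem iteratedFDeriv_succ_eq_curryFirst_symm (n : ℕ) (f : X → Y) :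
    iteratedFDeriv ℝ (n + 1) f = (curryFirst X Y n).symm ∘ fderiv ℝ (iteratedFDeriv ℝ n f) := rfl

theorem contDiff_curryFirst_symm (n : ℕ) {m : WithTop ℕ∞} :
    ContDiff ℝ m (curryFirst X Y n).symm :=
  ContinuousLinearEquiv.contDiff (𝕜 := ℝ) (E := X →L[ℝ] X [×n]→L[ℝ] Y)
    (F := X [×(n + 1)]→L[ℝ] Y) (curryFirst X Y n).symm

theorem fderiv_curryFirst_symm_comp (n : ℕ) {f : W → X →L[ℝ] X [×n]→L[ℝ] Y} {x : W} :
    fderiv ℝ ((curryFirst X Y n).symm ∘ f) x =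
      ((curryFirst X Y n).symm : _ →L[ℝ] _) ∘L fderiv ℝ f x :=
  ContinuousLinearEquiv.comp_fderiv (𝕜 := ℝ) (E := X →L[ℝ] X [×n]→L[ℝ] Y)
    (F := X [×(n + 1)]→L[ℝ] Y) (curryFirst X Y n).symm

/-- A multilinear map is symmetric if it is invariant under permutations of its arguments. -/
def IsSymmetric {n : ℕ} (f : X [×n]→L[ℝ] Y) : Prop :=
  ∀ (σ : Equiv.Perm (Fin n)) (v : Fin n → X), f (v ∘ σ) = f v

/-- Adjacent transpositions generate the symmetric group. -/
theorem isSymmetric_of_adjacent {n : ℕ} {f : X [×(n + 1)]→L[ℝ] Y}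
    (h : ∀ (i : Fin n) (v : Fin (n + 1) → X), f (v ∘ Equiv.swap i.castSucc i.succ) = f v) :
    IsSymmetric f := by
  intro σ
  have hσ : σ ∈ Submonoid.closure
      (Set.range fun i : Fin n ↦ Equiv.swap i.castSucc i.succ) := by
    rw [Equiv.Perm.mclosure_swap_castSucc_succ]; trivial
  induction hσ using Submonoid.closure_induction with
  | mem x hx => obtain ⟨i, rfl⟩ := hx; exact h i
  | one => intro v; simp
  | mul a b _ _ ha hb =>
    intro v
    have := hb (v ∘ a)
    rw [ha v] at this
    rw [← this]
    rfl

theorem swap_succ_apply_zero {n : ℕ} (i j : Fin n) :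
    Equiv.swap i.succ j.succ (0 : Fin (n + 1)) = 0 :=
  Equiv.swap_apply_of_ne_of_ne (Fin.succ_ne_zero _).symm (Fin.succ_ne_zero _).symm

theorem swap_succ_apply_succ {n : ℕ} (i j l : Fin n) :
    Equiv.swap i.succ j.succ l.succ = (Equiv.swap i j l).succ :=
  (Function.Injective.map_swap (Fin.succ_injective n) i j l).symm

/-- A multilinear map is symmetric if it is so in the last arguments and in the first two. -/
theorem isSymmetric_of_curryLeft {n : ℕ} {f : X [×(n + 2)]→L[ℝ] Y}
    (h : ∀ v, IsSymmetric (f.curryLeft v))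
    (h₂ : ∀ v w u, f (Fin.cons v (Fin.cons w u)) = f (Fin.cons w (Fin.cons v u))) :
    IsSymmetric f := by
  refine isSymmetric_of_adjacent fun i v => ?_
  -- The first adjacent transposition exchanges the first two arguments; all the others fix the
  -- first argument.
  induction i using Fin.cases with
  | zero =>
    have e : v = Fin.cons (v 0) (Fin.cons (v 1) fun j => v j.succ.succ) := by
      ext j
      refine Fin.cases rfl (fun j => Fin.cases rfl (fun j => rfl) j) j
    have e' : v ∘ Equiv.swap (Fin.castSucc (0 : Fin (n + 1))) (Fin.succ 0) =
        Fin.cons (v 1) (Fin.cons (v 0) fun j => v j.succ.succ) := by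
      ext j
      refine Fin.cases (by simp) (fun j => Fin.cases (by simp) (fun j => ?_) j) j
      simp only [Function.comp_apply, Fin.cons_succ]
      rw [Equiv.swap_apply_of_ne_of_ne]
      · exact Fin.succ_ne_zero _
      · exact fun h => Fin.succ_ne_zero _ (Fin.succ_injective _ h)
    rw [e', h₂, ← e]
  | succ i =>
    have := h (v 0) (Equiv.swap i.castSucc i.succ) (Fin.tail v)
    simp only [ContinuousMultilinearMap.curryLeft_apply, Fin.cons_self_tail] at this
    rw [← this]
    congr 1
    ext j
    refine Fin.cases ?_ (fun j => ?_) j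
    · simp only [Function.comp_apply, Fin.cons_zero]
      rw [Fin.castSucc_succ, swap_succ_apply_zero]
    · simp only [Function.comp_apply, Fin.cons_succ, Fin.tail]
      rw [Fin.castSucc_succ, swap_succ_apply_succ]

theorem isSymmetric_of_le_one {n : ℕ} (hn : n ≤ 1) (f : X [×n]→L[ℝ] Y) : IsSymmetric f := by
  intro σ v
  have : Subsingleton (Fin n) := Fin.subsingleton_iff_le_one.2 hn
  rw [Subsingleton.elim σ 1]
  rfl

/-- The derivative of a family of symmetric maps is symmetric. -/
theorem isSymmetric_fderiv_apply {n : ℕ} {f : W → X [×n]→L[ℝ] Y} {z : W}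
    (hd : DifferentiableAt ℝ f z) (h : ∀ᶠ w in 𝓝 z, IsSymmetric (f w)) (u : W) :
    IsSymmetric (fderiv ℝ f z u) := by
  intro σ v
  have key : ∀ v : Fin n → X, HasFDerivAt (fun w => f w v)
      ((ContinuousMultilinearMap.apply ℝ (fun _ : Fin n => X) Y v).comp (fderiv ℝ f z)) z :=
    fun v => (ContinuousMultilinearMap.apply ℝ (fun _ : Fin n => X) Y v).hasFDerivAt.comp z
      hd.hasFDerivAt
  have e : (fun w => f w (v ∘ σ)) =ᶠ[𝓝 z] fun w => f w v := h.mono fun w hw => hw σ v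
  have := ((key (v ∘ σ)).congr_of_eventuallyEq e.symm).unique (key v)
  exact DFunLike.congr_fun this u

/-- Induction on the order: symmetry in all arguments but the first is inherited from the previous
derivative, which is symmetric at nearby points, and symmetry in the first two arguments is
Schwarz's theorem. -/
theorem isSymmetric_iteratedFDeriv_of_contDiffAt {f : X → Y} (n : ℕ) :
    ∀ {x : X}, ContDiffAt ℝ n f x → IsSymmetric (iteratedFDeriv ℝ n f x) := by
  induction n with
  | zero => exact fun _ => isSymmetric_of_le_one (Nat.zero_le _) _
  | succ n ih =>
    intro x hf
    cases n with
    | zero => exact isSymmetric_of_le_one le_rfl _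
    | succ n =>
      refine isSymmetric_of_curryLeft (fun v => ?_) fun v w u => ?_
      · refine isSymmetric_fderiv_apply (hf.differentiableAt_iteratedFDeriv (by norm_cast; simp))
          ?_ v
        filter_upwards [hf.eventually (by simp)] with y hy
        exact ih (hy.of_le (by norm_cast; simp))
      · have h2 : ContDiffAt ℝ 2 (iteratedFDeriv ℝ n f) x :=
          hf.iteratedFDeriv_right (by norm_cast; omega)
        have hs := h2.isSymmSndFDerivAt (by simp)
        have hd : DifferentiableAt ℝ (fderiv ℝ (iteratedFDeriv ℝ n f)) x :=
          (h2.fderiv_right (m := 1) (by norm_num)).differentiableAt (by simp)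
        have key : ∀ v w, iteratedFDeriv ℝ (n + 2) f x (Fin.cons v (Fin.cons w u)) =
            fderiv ℝ (fderiv ℝ (iteratedFDeriv ℝ n f)) x v w u := by
          intro v w
          rw [iteratedFDeriv_succ_apply_left, iteratedFDeriv_succ_eq_curryFirst_symm,
            fderiv_curryFirst_symm_comp]
          rfl
        rw [key, key, hs v w]

theorem isSymmetric_iteratedFDeriv {f : X → Y} {x : X} (hf : ContDiffAt ℝ ∞ f x) (n : ℕ) :
    IsSymmetric (iteratedFDeriv ℝ n f x) :=
  isSymmetric_iteratedFDeriv_of_contDiffAt n (hf.of_le (by norm_cast; exact le_top))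

/-- Derivatives of a smooth family of maps depend smoothly on the parameter. -/
theorem contDiffAt_iteratedFDeriv_param {P : Type*} [NormedAddCommGroup P] [NormedSpace ℝ P]
    {g : P → X → Y} {p₀ : P} {x₀ : X} (hg : ContDiffAt ℝ ∞ (Function.uncurry g) (p₀, x₀)) (n : ℕ) :
    ContDiffAt ℝ ∞ (fun q : P × X => iteratedFDeriv ℝ n (g q.1) q.2) (p₀, x₀) := by
  induction n with
  | zero =>
    exact (LinearIsometryEquiv.contDiff
      (continuousMultilinearCurryFin0 ℝ X Y).symm).contDiffAt.comp _ hg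
  | succ n ih =>
    refine (contDiff_curryFirst_symm n).contDiffAt.comp _ ?_
    refine ContDiffAt.fderiv (f := fun q : P × X => iteratedFDeriv ℝ n (g q.1))
      (g := Prod.snd) (n := ∞) ?_ contDiffAt_snd (by simp)
    exact ContDiffAt.comp ((p₀, x₀), x₀) (g := fun q : P × X => iteratedFDeriv ℝ n (g q.1) q.2)
      (f := fun a : (P × X) × X => (a.1.1, a.2)) ih (by fun_prop)

/-- Two maps have the same derivatives up to order `k` at a point. -/
def AgreeToOrder (k : ℕ) (f g : X → Y) (x : X) : Prop :=
  ∀ i ≤ k, iteratedFDeriv ℝ i f x = iteratedFDeriv ℝ i g x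

theorem AgreeToOrder.eq {k : ℕ} {f g : X → Y} {x : X} (h : AgreeToOrder k f g x) : f x = g x := by
  have := DFunLike.congr_fun (h 0 (Nat.zero_le _)) (fun i => i.elim0)
  simpa using this

/-- By Faà di Bruno's formula the i-th derivative of F ∘ f uses only derivatives of f of order at
most i, since the parts of a partition of i elements have size at most i. -/
theorem AgreeToOrder.comp_left {k : ℕ} {f g : X → Y} {x : X} (h : AgreeToOrder k f g x)
    (hf : ContDiffAt ℝ ∞ f x) (hg : ContDiffAt ℝ ∞ g x) {F : Y → W}
    (hF : ContDiffAt ℝ ∞ F (f x)) : AgreeToOrder k (F ∘ f) (F ∘ g) x := by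
  intro i hi
  rw [iteratedFDeriv_comp hF hf (by norm_cast; exact le_top),
    iteratedFDeriv_comp (h.eq ▸ hF) hg (by norm_cast; exact le_top), h.eq]
  refine Finset.sum_congr rfl fun c _ => ?_
  ext v
  simp only [FormalMultilinearSeries.compAlongOrderedFinpartition_apply]
  congr 1
  ext m
  simp only [OrderedFinpartition.applyOrderedFinpartition_apply, ftaylorSeries]
  rw [h _ ((c.partSize_le _).trans hi)]

/-- Faà di Bruno again: the outer map is differentiated as often as the partition has parts, hence
at most i times. -/
theorem AgreeToOrder.comp_right {k : ℕ} {f g : X → Y} {τ : W → X} {w : W}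
    (h : AgreeToOrder k f g (τ w))
    (hf : ContDiffAt ℝ ∞ f (τ w)) (hg : ContDiffAt ℝ ∞ g (τ w)) 
    (hτ : ContDiffAt ℝ ∞ τ w) : AgreeToOrder k (f ∘ τ) (g ∘ τ) w := by
  intro i hi
  rw [iteratedFDeriv_comp hf hτ (by norm_cast; exact le_top),
    iteratedFDeriv_comp hg hτ (by norm_cast; exact le_top)]
  refine Finset.sum_congr rfl fun c _ => ?_
  ext v
  simp only [FormalMultilinearSeries.compAlongOrderedFinpartition_apply, ftaylorSeries]
  rw [h _ (c.length_le.trans hi)]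

theorem AgreeToOrder.prodMk {k : ℕ} {f g : X → Y} {f' g' : X → W} {x : X}
    (h : AgreeToOrder k f g x) (h' : AgreeToOrder k f' g' x)
    (hf : ContDiffAt ℝ ∞ f x) (hg : ContDiffAt ℝ ∞ g x)
    (hf' : ContDiffAt ℝ ∞ f' x) (hg' : ContDiffAt ℝ ∞ g' x) :
    AgreeToOrder k (fun y => (f y, f' y)) (fun y => (g y, g' y)) x := by
  intro i hi
  rw [iteratedFDeriv_prodMk hf hf' (by norm_cast; exact le_top),
    iteratedFDeriv_prodMk hg hg' (by norm_cast; exact le_top), h i hi, h' i hi]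

theorem AgreeToOrder.congr {k : ℕ} {f g f' g' : X → Y} {x : X} (h : AgreeToOrder k f g x)
    (hf : f' =ᶠ[𝓝 x] f) (hg : g' =ᶠ[𝓝 x] g) : AgreeToOrder k f' g' x := by
  intro i hi
  rw [(hf.iteratedFDeriv ℝ i).eq_of_nhds, (hg.iteratedFDeriv ℝ i).eq_of_nhds, h i hi]

/-- The polynomial map with prescribed derivatives at `ζ.1`. -/
def jetPolynomial {k : ℕ} (ζ : JetCoord X Y k) (x : X) : Y :=
  ∑ j : Fin (k + 1), ((Nat.factorial (j : ℕ) : ℝ)⁻¹) • ζ.2 j (fun _ => x - ζ.1)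

/-- Smoothness in the jet coordinates as well as in the point is what makes changes of jet
coordinates smooth. -/
theorem contDiff_jetPolynomial (k : ℕ) :
    ContDiff ℝ ∞ (fun q : JetCoord X Y k × X => jetPolynomial q.1 q.2) := by
  unfold jetPolynomial
  refine ContDiff.sum fun j _ => contDiff_const.smul ?_
  have h : ContDiff ℝ ∞ (fun q : (X [×(j : ℕ)]→L[ℝ] Y) × ((Fin (j : ℕ)) → X) => q.1 q.2) :=
    AnalyticOnNhd.contDiff fun q _ => ContinuousLinearMap.analyticAt_uncurry_of_multilinear
      (ContinuousLinearMap.id ℝ (X [×(j : ℕ)]→L[ℝ] Y))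
  refine h.comp (f := fun q : JetCoord X Y k × X => (q.1.2 j, fun _ => q.2 - q.1.1)) ?_
  refine ContDiff.prodMk ?_ (contDiff_pi.2 fun _ => by fun_prop)
  exact (ContinuousLinearMap.contDiff (ContinuousLinearMap.proj (R := ℝ)
    (φ := fun j : Fin (k + 1) => X [×(j : ℕ)]→L[ℝ] Y) j)).comp (contDiff_snd.comp contDiff_fst)

/-- The j-th derivative of a homogeneous polynomial of degree j is the sum of its multilinear
coefficient over all permutations of the arguments. For a symmetric coefficient this is j! times the
coefficient, which the factor 1/j! cancels. -/
theorem iteratedFDeriv_jetPolynomial [CompleteSpace Y] {k : ℕ} (ζ : JetCoord X Y k) (j : Fin (k + 1))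
    (hj : IsSymmetric (ζ.2 j)) : iteratedFDeriv ℝ (j : ℕ) (jetPolynomial ζ) ζ.1 = ζ.2 j := by
  let p : FormalMultilinearSeries ℝ X Y := fun n =>
    if h : n < k + 1 then ((Nat.factorial n : ℝ)⁻¹) • ζ.2 ⟨n, h⟩ else 0
  have hp : HasFiniteFPowerSeriesOnBall (jetPolynomial ζ) p ζ.1 (k + 1) ⊤ := by
    refine HasFiniteFPowerSeriesOnBall.mk' (fun m hm => ?_) (by simp) fun y _ => ?_
    · exact dif_neg (Nat.not_lt.2 hm)
    · rw [Finset.sum_range]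
      simp only [jetPolynomial, add_sub_cancel_left]
      refine Finset.sum_congr rfl fun i _ => ?_
      simp only [p, i.2, dif_pos, smul_apply]
  ext v
  rw [hp.toHasFPowerSeriesOnBall.iteratedFDeriv_eq_sum_of_completeSpace]
  have : ∀ σ : Equiv.Perm (Fin (j : ℕ)), p j (fun i => v (σ i)) =
      ((Nat.factorial (j : ℕ) : ℝ)⁻¹) • ζ.2 j v := by
    intro σ
    simp only [p, j.2, dif_pos, smul_apply]
    congr 1
    exact hj σ v
  rw [Finset.sum_congr rfl fun σ _ => this σ, Finset.sum_const, Finset.card_univ,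
    Fintype.card_perm, Fintype.card_fin, ← Nat.cast_smul_eq_nsmul ℝ, smul_smul,
    mul_inv_cancel₀ (by positivity), one_smul]

end Calculus

/-! ### Fibered charts, sections in coordinates, changes of jet coordinates. -/

section Charts

open Set Filter

variable {X Y : Type*} [NormedAddCommGroup X] [NormedSpace ℝ X]
  [NormedAddCommGroup Y] [NormedSpace ℝ Y]
  {M E : Type*} [TopologicalSpace M] [ChartedSpace X M]
  [TopologicalSpace E] [ChartedSpace (X × Y) E] {π : E → M}

/-- Every point of a smooth fibered manifold lies in the domain of fibered coordinates. -/
theorem IsFibered.exists_fiberedChart [FiniteDimensional ℝ X] [FiniteDimensional ℝ Y]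
    [IsManifold 𝓘(ℝ, X × Y) ∞ E] (hπ : IsFibered X (X × Y) π) (q : E) :
    ∃ c : FiberedChart X Y π, q ∈ c.total.source := by
  have h := hπ.submersion.isSubmersionAt q
  have hfd : FiniteDimensional ℝ (X × h.complement) :=
    LinearEquiv.finiteDimensional h.equiv.toLinearEquiv
  have hfd' : FiniteDimensional ℝ h.complement :=
    FiniteDimensional.of_surjective (LinearMap.snd ℝ X h.complement) LinearMap.snd_surjective
  -- The normal form of a submersion provides only some complement of `X` in the model; counting
  -- dimensions identifies it with `Y`.
  have hrank : Module.finrank ℝ h.complement = Module.finrank ℝ Y := by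
    have := h.equiv.toLinearEquiv.finrank_eq
    rw [Module.finrank_prod, Module.finrank_prod] at this
    omega
  let e : (X × Y) ≃L[ℝ] (X × Y) := h.equiv.trans
    ((ContinuousLinearEquiv.refl ℝ X).prodCongr (ContinuousLinearEquiv.ofFinrankEq hrank))
  have hdom := h.domChart_mem_maximalAtlas
  refine ⟨⟨h.domChart.transHomeomorph e.toHomeomorph, h.codChart, ?_,
    h.codChart_mem_maximalAtlas, fun q hq => h.source_subset_preimage_source hq,
    fun q hq => ?_⟩, h.mem_domChart_source⟩
  · refine OpenPartialHomeomorph.mem_maximalAtlas_of_contMDiffOn _ ?_ ?_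
    · exact e.contDiff.contMDiff.comp_contMDiffOn (contMDiffOn_of_mem_maximalAtlas hdom)
    · exact (contMDiffOn_symm_of_mem_maximalAtlas hdom).comp
        e.symm.contDiff.contMDiff.contMDiffOn fun _ hx => hx
  · have h1 := h.writtenInCharts (show h.domChart q ∈ (h.domChart.extend 𝓘(ℝ, X × Y)).target by
      simpa using h.domChart.map_source hq)
    have h2 : h.domChart.symm (h.domChart q) = q := h.domChart.left_inv hq
    simp only [Function.comp_apply, OpenPartialHomeomorph.extend_coe,
      OpenPartialHomeomorph.extend_coe_symm, modelWithCornersSelf_coe,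
      modelWithCornersSelf_coe_symm, id_eq, h2] at h1
    exact h1.symm

namespace FiberedChart

variable (c c' : FiberedChart X Y π)

theorem fst_mem_target {z : X × Y} (hz : z ∈ c.total.target) : z.1 ∈ c.base.target := by
  have h := c.fst_apply _ (c.total.map_target hz)
  rw [c.total.right_inv hz] at h
  rw [h]
  exact c.base.map_source (c.mapsTo _ (c.total.map_target hz))

theorem base_symm_fst {z : X × Y} (hz : z ∈ c.total.target) :
    c.base.symm z.1 = π (c.total.symm z) := by
  have h := c.fst_apply _ (c.total.map_target hz)
  rw [c.total.right_inv hz] at h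
  rw [h, c.base.left_inv (c.mapsTo _ (c.total.map_target hz))]

/-- The fiber component of the change of fibered coordinates. -/
def transFiber (z : X × Y) : Y := (c'.total (c.total.symm z)).2

/-- The change of base coordinates. -/
def transBase (x : X) : X := c.base (c'.base.symm x)

variable {c c'}

theorem contDiffAt_transBase {x : X} (hx : x ∈ c'.base.target)
    (hx' : c'.base.symm x ∈ c.base.source) : ContDiffAt ℝ ∞ (transBase c c') x := by
  rw [← contMDiffAt_iff_contDiffAt]
  exact (contMDiffAt_of_mem_maximalAtlas c.base_mem hx').comp x
    (contMDiffAt_symm_of_mem_maximalAtlas c'.base_mem hx)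

theorem contDiffAt_total_trans {z : X × Y} (hz : z ∈ c.total.target)
    (hz' : c.total.symm z ∈ c'.total.source) :
    ContDiffAt ℝ ∞ (fun z => c'.total (c.total.symm z)) z := by
  rw [← contMDiffAt_iff_contDiffAt]
  exact (contMDiffAt_of_mem_maximalAtlas c'.total_mem hz').comp z
    (contMDiffAt_symm_of_mem_maximalAtlas c.total_mem hz)

theorem contDiffAt_transFiber {z : X × Y} (hz : z ∈ c.total.target)
    (hz' : c.total.symm z ∈ c'.total.source) :
    ContDiffAt ℝ ∞ (transFiber c c') z :=
  contDiffAt_snd.comp z (contDiffAt_total_trans hz hz')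

end FiberedChart

namespace LocalSection

variable (s : LocalSection X (X × Y) π) {c c' : FiberedChart X Y π} {p : M}

theorem base_mem (hp : p ∈ s.domain) (hc : s.toFun p ∈ c.total.source) : p ∈ c.base.source := by
  have := c.mapsTo _ hc
  rwa [s.proj_apply p hp] at this

theorem total_apply (hp : p ∈ s.domain) (hc : s.toFun p ∈ c.total.source) :
    c.total (s.toFun p) = (c.base p, s.rep c (c.base p)) := by
  refine Prod.ext ?_ ?_
  · rw [c.fst_apply _ hc, s.proj_apply p hp]
  · simp only [rep]
    rw [c.base.left_inv (s.base_mem hp hc)]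

theorem contMDiffAt_toFun (hp : p ∈ s.domain) :
    ContMDiffAt 𝓘(ℝ, X) 𝓘(ℝ, X × Y) ∞ s.toFun p :=
  s.contMDiffOn.contMDiffAt (s.isOpen_domain.mem_nhds hp)

theorem eventually_mem (hp : p ∈ s.domain) (hc : s.toFun p ∈ c.total.source) :
    ∀ᶠ q in 𝓝 p, q ∈ s.domain ∧ s.toFun q ∈ c.total.source :=
  Filter.inter_mem (s.isOpen_domain.mem_nhds hp) ((s.contMDiffAt_toFun hp).continuousAt.preimage_mem_nhds
    (c.total.open_source.mem_nhds hc))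

theorem eventually_base_symm (hp : p ∈ s.domain) (hc : s.toFun p ∈ c.total.source) {P : M → Prop}
    (h : ∀ᶠ q in 𝓝 p, P q) : ∀ᶠ x in 𝓝 (c.base p), P (c.base.symm x) :=
  (c.base.tendsto_symm (s.base_mem hp hc)).eventually h

theorem contDiffAt_rep (hp : p ∈ s.domain) (hc : s.toFun p ∈ c.total.source) :
    ContDiffAt ℝ ∞ (s.rep c) (c.base p) := by
  have hb := s.base_mem hp hc
  rw [← contMDiffAt_iff_contDiffAt]
  have h1 : ContMDiffAt 𝓘(ℝ, X) 𝓘(ℝ, X) ∞ c.base.symm (c.base p) :=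
    contMDiffAt_symm_of_mem_maximalAtlas c.base_mem (c.base.map_source hb)
  have h2 := c.base.left_inv hb
  refine ContMDiffAt.comp (I' := 𝓘(ℝ, X × Y)) (c.base p) contDiffAt_snd.contMDiffAt
    (ContMDiffAt.comp (I' := 𝓘(ℝ, X × Y)) (c.base p) (g := c.total) ?_
      (ContMDiffAt.comp (I' := 𝓘(ℝ, X)) (c.base p) (g := s.toFun) ?_ h1))
  · simp only [h2]
    exact contMDiffAt_of_mem_maximalAtlas c.total_mem hc
  · rw [h2]
    exact s.contMDiffAt_toFun hp

theorem contDiffAt_prolongRep (k : ℕ) (hp : p ∈ s.domain) (hc : s.toFun p ∈ c.total.source) :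
    ContDiffAt ℝ ∞ (s.prolongRep c k) (c.base p) :=
  contDiffAt_id.prodMk (contDiffAt_pi.2 fun j =>
    (s.contDiffAt_rep hp hc).iteratedFDeriv_right (by exact_mod_cast le_top))

/-- Change of fibered coordinates for a local section. -/
theorem rep_eventuallyEq (hp : p ∈ s.domain) (hc : s.toFun p ∈ c.total.source)
    (hc' : s.toFun p ∈ c'.total.source) :
    s.rep c' =ᶠ[𝓝 (c'.base p)] fun x => FiberedChart.transFiber c c'
      (FiberedChart.transBase c c' x, s.rep c (FiberedChart.transBase c c' x)) := by
  filter_upwards [s.eventually_base_symm hp hc' (s.eventually_mem hp hc)] with x hx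
  rw [FiberedChart.transBase, ← s.total_apply hx.1 hx.2, FiberedChart.transFiber,
    c.total.left_inv hx.2]
  rfl

end LocalSection

namespace FiberedChart

/-- The local section with a given expression in fibered coordinates. -/
def toSection (c : FiberedChart X Y π) (y : X → Y) {U : Set X} (hU : IsOpen U)
    (hy : ContDiffOn ℝ ∞ y U) (hmem : ∀ x ∈ U, (x, y x) ∈ c.total.target) :
    LocalSection X (X × Y) π where
  domain := c.base.source ∩ c.base ⁻¹' U
  isOpen_domain := c.base.isOpen_inter_preimage hU
  toFun p := c.total.symm (c.base p, y (c.base p))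
  contMDiffOn := by
    intro p hp
    have h1 : ContMDiffAt 𝓘(ℝ, X) 𝓘(ℝ, X) ∞ c.base p :=
      contMDiffAt_of_mem_maximalAtlas c.base_mem hp.1
    have h2 : ContMDiffAt 𝓘(ℝ, X) 𝓘(ℝ, X × Y) ∞ (fun x => (x, y x)) (c.base p) :=
      (contDiffAt_id.prodMk (hy.contDiffAt (hU.mem_nhds hp.2))).contMDiffAt
    exact ((contMDiffAt_symm_of_mem_maximalAtlas c.total_mem (hmem _ hp.2)).comp p
      (h2.comp p h1)).contMDiffWithinAt
  proj_apply p hp := by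
    rw [← c.base_symm_fst (hmem _ hp.2), c.base.left_inv hp.1]

variable {c : FiberedChart X Y π} {y : X → Y} {U : Set X} {hU : IsOpen U}
  {hy : ContDiffOn ℝ ∞ y U} {hmem : ∀ x ∈ U, (x, y x) ∈ c.total.target} {x : X}

theorem symm_mem_toSection_domain (hx : x ∈ U) :
    c.base.symm x ∈ (c.toSection y hU hy hmem).domain := by
  have := c.fst_mem_target (hmem x hx)
  exact ⟨c.base.map_target this, by rwa [mem_preimage, c.base.right_inv this]⟩

theorem toSection_toFun (hx : x ∈ U) :
    (c.toSection y hU hy hmem).toFun (c.base.symm x) = c.total.symm (x, y x) := by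
  simp only [toSection]
  rw [c.base.right_inv (c.fst_mem_target (hmem x hx))]

theorem toSection_mem_source (hx : x ∈ U) :
    (c.toSection y hU hy hmem).toFun (c.base.symm x) ∈ c.total.source := by
  rw [toSection_toFun hx]; exact c.total.map_target (hmem x hx)

theorem toSection_rep (hx : x ∈ U) : (c.toSection y hU hy hmem).rep c x = y x := by
  rw [LocalSection.rep, toSection_toFun hx, c.total.right_inv (hmem x hx)]

theorem toSection_rep_eventuallyEq (hx : x ∈ U) : (c.toSection y hU hy hmem).rep c =ᶠ[𝓝 x] y :=
  Filter.mem_of_superset (hU.mem_nhds hx) fun _ hx => toSection_rep hx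

theorem toSection_prolongRep (k : ℕ) (hx : x ∈ U) : (c.toSection y hU hy hmem).prolongRep c k x =
    (x, fun j : Fin (k + 1) => iteratedFDeriv ℝ (j : ℕ) y x) :=
  Prod.ext rfl (funext fun _ => ((toSection_rep_eventuallyEq hx).iteratedFDeriv ℝ _).eq_of_nhds)

end FiberedChart

/-- The point of the total space (in fibered coordinates) underlying jet coordinates. -/
def JetCoord.toTotal {k : ℕ} (ζ : JetCoord X Y k) : X × Y := (ζ.1, ζ.2 0 fun i => i.elim0)

theorem JetCoord.continuous_toTotal {k : ℕ} :
    Continuous (JetCoord.toTotal : JetCoord X Y k → X × Y) := by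
  refine continuous_fst.prodMk ?_
  exact (ContinuousMultilinearMap.apply ℝ (fun _ : Fin ((0 : Fin (k + 1)) : ℕ) => X) Y
    fun i => i.elim0).continuous.comp ((continuous_apply 0).comp continuous_snd)

theorem LocalSection.prolongRep_toTotal (s : LocalSection X (X × Y) π) (c : FiberedChart X Y π)
    (k : ℕ) (x : X) : (s.prolongRep c k x).toTotal = (x, s.rep c x) := rfl

theorem jetPolynomial_apply_self {k : ℕ} (ζ : JetCoord X Y k) :
    jetPolynomial ζ ζ.1 = ζ.2 0 fun i => i.elim0 := by
  rw [jetPolynomial, Fin.sum_univ_succ]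
  have h0 : ∀ j : Fin k, ζ.2 j.succ (fun _ => ζ.1 - ζ.1) = 0 := fun j =>
    (ζ.2 j.succ).map_coord_zero (⟨0, by simp⟩ : Fin ((j.succ : Fin (k + 1)) : ℕ)) (sub_self _)
  simp only [h0, smul_zero, Finset.sum_const_zero, add_zero]
  simp only [Fin.val_zero, Nat.factorial_zero, Nat.cast_one, inv_one, one_smul]
  congr 1
  ext i
  exact i.elim0

/-- The change of jet coordinates, from the fibered coordinates `c` to `c'`. -/
def jetTransition (c c' : FiberedChart X Y π) (k : ℕ) (ζ : JetCoord X Y k) : JetCoord X Y k :=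
  (c'.base (c.base.symm ζ.1), fun j : Fin (k + 1) => iteratedFDeriv ℝ (j : ℕ)
    (fun x => FiberedChart.transFiber c c' (FiberedChart.transBase c c' x,
      jetPolynomial ζ (FiberedChart.transBase c c' x))) (c'.base (c.base.symm ζ.1)))

theorem agreeToOrder_jetPolynomial [CompleteSpace Y] {k : ℕ} {y : X → Y} {x : X}
    (hy : ContDiffAt ℝ ∞ y x) : AgreeToOrder k y
      (jetPolynomial (x, fun j : Fin (k + 1) => iteratedFDeriv ℝ (j : ℕ) y x)) x := by
  intro i hi
  exact (iteratedFDeriv_jetPolynomial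
    (x, fun j : Fin (k + 1) => iteratedFDeriv ℝ (j : ℕ) y x) ⟨i, Nat.lt_succ_of_le hi⟩
    (isSymmetric_iteratedFDeriv hy i)).symm

theorem contDiff_jetPolynomial_right {k : ℕ} (ζ : JetCoord X Y k) :
    ContDiff ℝ ∞ (jetPolynomial ζ) :=
  (contDiff_jetPolynomial k).comp (contDiff_prodMk_right ζ)

/-- Change of jet coordinates of a section. -/
theorem LocalSection.prolongRep_eq_jetTransition [CompleteSpace Y]
    (s : LocalSection X (X × Y) π) {c c' : FiberedChart X Y π} {p : M} (k : ℕ)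
    (hp : p ∈ s.domain) (hc : s.toFun p ∈ c.total.source) (hc' : s.toFun p ∈ c'.total.source) :
    s.prolongRep c' k (c'.base p) = jetTransition c c' k (s.prolongRep c k (c.base p)) := by
  have hb := s.base_mem hp hc
  have hb' := s.base_mem hp hc'
  have hx : c'.base (c.base.symm (c.base p)) = c'.base p := by rw [c.base.left_inv hb]
  have hτ : FiberedChart.transBase c c' (c'.base p) = c.base p := by
    rw [FiberedChart.transBase, c'.base.left_inv hb']
  have hτs : ContDiffAt ℝ ∞ (FiberedChart.transBase c c') (c'.base p) :=
    FiberedChart.contDiffAt_transBase (c'.base.map_source hb')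
      (by rwa [c'.base.left_inv hb'])
  have hrep := s.contDiffAt_rep hp hc
  -- Only the k-jet matters, so the section may be replaced by its Taylor polynomial, from which
  -- `jetTransition` is defined; agreement to order k survives composition with the change of
  -- fibered coordinates on both sides.
  set P := jetPolynomial (s.prolongRep c k (c.base p)) with hP
  have hPs : ContDiffAt ℝ ∞ P (c.base p) := (contDiff_jetPolynomial_right _).contDiffAt
  have h1 : AgreeToOrder k (s.rep c) P (c.base p) := agreeToOrder_jetPolynomial hrep
  have h2 : AgreeToOrder k (fun x => (x, s.rep c x)) (fun x => (x, P x)) (c.base p) :=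
    AgreeToOrder.prodMk (fun _ _ => rfl) h1 contDiffAt_id contDiffAt_id hrep hPs
  have htot := s.total_apply hp hc
  have h3 := h2.comp_left (contDiffAt_id.prodMk hrep) (contDiffAt_id.prodMk hPs)
    (F := FiberedChart.transFiber c c') (FiberedChart.contDiffAt_transFiber
      (by rw [← htot]; exact c.total.map_source hc)
      (by rw [← htot, c.total.left_inv hc]; exact hc'))
  have hF : ContDiffAt ℝ ∞ (FiberedChart.transFiber c c') (c.base p, s.rep c (c.base p)) :=
    FiberedChart.contDiffAt_transFiber (by rw [← htot]; exact c.total.map_source hc)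
      (by rw [← htot, c.total.left_inv hc]; exact hc')
  have h4 := AgreeToOrder.comp_right (τ := FiberedChart.transBase c c') (w := c'.base p)
    (hτ.symm ▸ h3) (hτ.symm ▸ hF.comp (c.base p) (contDiffAt_id.prodMk hrep))
    (hτ.symm ▸ (h1.eq ▸ hF).comp (c.base p) (contDiffAt_id.prodMk hPs)) hτs
  have h5 := h4.congr (s.rep_eventuallyEq hp hc hc') EventuallyEq.rfl
  refine Prod.ext hx.symm (funext fun j => ?_)
  refine (h5 j (Nat.lt_succ_iff.1 j.2)).trans ?_
  simp only [jetTransition]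
  rw [show (s.prolongRep c k (c.base p)).1 = c.base p from rfl, hx]
  rfl

/-- The change of jet coordinates is smooth. -/
theorem contDiffAt_jetTransition {c c' : FiberedChart X Y π} {k : ℕ} {ζ : JetCoord X Y k}
    (h : ζ.toTotal ∈ c.total.target) (h' : c.total.symm ζ.toTotal ∈ c'.total.source) :
    ContDiffAt ℝ ∞ (jetTransition c c' k) ζ := by
  have hb : ζ.1 ∈ c.base.target := c.fst_mem_target h
  have hs : c.base.symm ζ.1 = π (c.total.symm ζ.toTotal) := c.base_symm_fst h
  have hb' : c.base.symm ζ.1 ∈ c'.base.source := by rw [hs]; exact c'.mapsTo _ h'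
  have hx : ContDiffAt ℝ ∞ (fun ζ : JetCoord X Y k => c'.base (c.base.symm ζ.1)) ζ :=
    (FiberedChart.contDiffAt_transBase (c := c') (c' := c) hb hb').comp ζ contDiffAt_fst
  have hτ : FiberedChart.transBase c c' (c'.base (c.base.symm ζ.1)) = ζ.1 := by
    rw [FiberedChart.transBase, c'.base.left_inv hb', c.base.right_inv hb]
  refine hx.prodMk (contDiffAt_pi.2 fun j => ?_)
  -- The Taylor polynomial read in the new chart, as a family with parameter the jet coordinates.
  -- Symmetry of ζ is not required, so smoothness makes sense at any point of the vector space over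
  -- the chart overlap.
  let g : JetCoord X Y k → X → Y := fun ζ x => FiberedChart.transFiber c c'
    (FiberedChart.transBase c c' x, jetPolynomial ζ (FiberedChart.transBase c c' x))
  have hg : ContDiffAt ℝ ∞ (Function.uncurry g) (ζ, c'.base (c.base.symm ζ.1)) := by
    have h0 : ContDiffAt ℝ ∞ (FiberedChart.transBase c c') (c'.base (c.base.symm ζ.1)) :=
      FiberedChart.contDiffAt_transBase (c'.base.map_source hb')
        (by rw [c'.base.left_inv hb']; exact c.base.map_target hb)
    have h1 : ContDiffAt ℝ ∞ (fun q : JetCoord X Y k × X => FiberedChart.transBase c c' q.2)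
        (ζ, c'.base (c.base.symm ζ.1)) :=
      ContDiffAt.comp (g := FiberedChart.transBase c c') (f := Prod.snd)
        (ζ, c'.base (c.base.symm ζ.1)) h0 contDiffAt_snd
    refine ContDiffAt.comp (g := FiberedChart.transFiber c c') _ ?_ (h1.prodMk
      ((contDiff_jetPolynomial k).contDiffAt.comp _ (contDiffAt_fst.prodMk h1)))
    simp only [hτ, jetPolynomial_apply_self]
    exact FiberedChart.contDiffAt_transFiber h h'
  exact (contDiffAt_iteratedFDeriv_param hg j).comp ζ (contDiffAt_id.prodMk hx)

end Charts

/-! ### The space of jets: coordinates and topology. -/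

section JetSpace

open Set Filter

theorem finiteDimensional_continuousMultilinearMap (X Y : Type*)
    [NormedAddCommGroup X] [NormedSpace ℝ X] [FiniteDimensional ℝ X]
    [NormedAddCommGroup Y] [NormedSpace ℝ Y] [FiniteDimensional ℝ Y] (n : ℕ) :
    FiniteDimensional ℝ (X [×n]→L[ℝ] Y) := by
  induction n with
  | zero =>
    exact LinearEquiv.finiteDimensional
      (continuousMultilinearCurryFin0 ℝ X Y).symm.toLinearEquiv
  | succ n ih => exact LinearEquiv.finiteDimensional (curryFirst X Y n).symm.toLinearEquiv

instance instFiniteDimensionalJetCoord (X Y : Type*)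
    [NormedAddCommGroup X] [NormedSpace ℝ X] [FiniteDimensional ℝ X]
    [NormedAddCommGroup Y] [NormedSpace ℝ Y] [FiniteDimensional ℝ Y] (k : ℕ) :
    FiniteDimensional ℝ (JetCoord X Y k) := by
  have : ∀ j : Fin (k + 1), FiniteDimensional ℝ (X [×(j : ℕ)]→L[ℝ] Y) := fun j =>
    finiteDimensional_continuousMultilinearMap X Y j
  infer_instance

variable {X Y : Type*} [NormedAddCommGroup X] [NormedSpace ℝ X]
  [NormedAddCommGroup Y] [NormedSpace ℝ Y]
  {M E : Type*} [TopologicalSpace M] [ChartedSpace X M]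
  [TopologicalSpace E] [ChartedSpace (X × Y) E] {π : E → M}

/-- Forgetting the derivatives of highest order. -/
def JetCoord.truncate (X Y : Type*) [NormedAddCommGroup X] [NormedSpace ℝ X]
    [NormedAddCommGroup Y] [NormedSpace ℝ Y] (k : ℕ) :
    JetCoord X Y (k + 1) →L[ℝ] JetCoord X Y k :=
  (ContinuousLinearMap.fst ℝ X _).prod
    (ContinuousLinearMap.pi fun j : Fin (k + 1) =>
      (ContinuousLinearMap.proj (R := ℝ) (φ := fun j : Fin (k + 2) => X [×(j : ℕ)]→L[ℝ] Y)
        j.castSucc).comp (ContinuousLinearMap.snd ℝ X _))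

namespace Jet

variable {k : ℕ} {c c' : FiberedChart X Y π}

theorem exists_section (z : Jet X Y π k) :
    ∃ (s : LocalSection X (X × Y) π) (p : M) (hp : p ∈ s.domain), s.jet k p hp = z := by
  induction z using Quotient.inductionOn with
  | h a => exact ⟨a.1, a.2, a.2.2, rfl⟩

theorem base_jet (s : LocalSection X (X × Y) π) (p : M) (hp : p ∈ s.domain) :
    (s.jet k p hp).base = p := rfl

theorem target_jet (s : LocalSection X (X × Y) π) (p : M) (hp : p ∈ s.domain) :
    (s.jet k p hp).target = s.toFun p := rfl

theorem proj_jet (s : LocalSection X (X × Y) π) (p : M) (hp : p ∈ s.domain) :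
    (s.jet (k + 1) p hp).proj = s.jet k p hp := rfl

theorem coord_jet (s : LocalSection X (X × Y) π) (p : M) (hp : p ∈ s.domain)
    (hc : s.toFun p ∈ c.total.source) :
    coord c (s.jet k p hp) = s.prolongRep c k (c.base p) := if_pos hc

theorem target_proj (z : Jet X Y π (k + 1)) : z.proj.target = z.target := by
  obtain ⟨s, p, hp, rfl⟩ := z.exists_section; rfl

theorem base_proj (z : Jet X Y π (k + 1)) : z.proj.base = z.base := by
  obtain ⟨s, p, hp, rfl⟩ := z.exists_section; rfl

theorem coord_proj {z : Jet X Y π (k + 1)} (hz : z.target ∈ c.total.source) :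
    coord c z.proj = JetCoord.truncate X Y k (coord c z) := by
  obtain ⟨s, p, hp, rfl⟩ := z.exists_section
  rw [proj_jet, coord_jet s p hp hz, coord_jet s p hp hz]
  rfl

theorem proj_target (z : Jet X Y π k) : π z.target = z.base := by
  obtain ⟨s, p, hp, rfl⟩ := z.exists_section
  exact s.proj_apply p hp

theorem coord_fst {z : Jet X Y π k} (hz : z.target ∈ c.total.source) :
    (coord c z).1 = c.base z.base := by
  obtain ⟨s, p, hp, rfl⟩ := z.exists_section
  rw [coord_jet s p hp hz]
  rfl

theorem base_mem {z : Jet X Y π k} (hz : z.target ∈ c.total.source) : z.base ∈ c.base.source := by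
  rw [← proj_target]; exact c.mapsTo _ hz

theorem coord_toTotal {z : Jet X Y π k} (hz : z.target ∈ c.total.source) :
    (coord c z).toTotal = c.total z.target := by
  obtain ⟨s, p, hp, rfl⟩ := z.exists_section
  rw [coord_jet s p hp hz, s.prolongRep_toTotal, target_jet, s.total_apply hp hz]

theorem toTotal_mem {z : Jet X Y π k} (hz : z.target ∈ c.total.source) :
    (coord c z).toTotal ∈ c.total.target := by
  rw [coord_toTotal hz]; exact c.total.map_source hz

theorem symm_toTotal {z : Jet X Y π k} (hz : z.target ∈ c.total.source) :
    c.total.symm (coord c z).toTotal = z.target := by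
  rw [coord_toTotal hz, c.total.left_inv hz]

theorem isSymmetric_coord {z : Jet X Y π k} (hz : z.target ∈ c.total.source) (j : Fin (k + 1)) :
    IsSymmetric ((coord c z).2 j) := by
  obtain ⟨s, p, hp, rfl⟩ := z.exists_section
  rw [coord_jet s p hp hz]
  exact isSymmetric_iteratedFDeriv (s.contDiffAt_rep hp hz) j

theorem coord_eq_jetTransition [CompleteSpace Y] {z : Jet X Y π k} (hz : z.target ∈ c.total.source)
    (hz' : z.target ∈ c'.total.source) : coord c' z = jetTransition c c' k (coord c z) := by
  obtain ⟨s, p, hp, rfl⟩ := z.exists_section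
  rw [coord_jet s p hp hz, coord_jet s p hp hz']
  exact s.prolongRep_eq_jetTransition k hp hz hz'

theorem contDiffAt_jetTransition_coord {z : Jet X Y π k} (hz : z.target ∈ c.total.source)
    (hz' : z.target ∈ c'.total.source) :
    ContDiffAt ℝ ∞ (jetTransition c c' k) (coord c z) :=
  contDiffAt_jetTransition (toTotal_mem hz) (by rwa [symm_toTotal hz])

/-- A jet is determined by its coordinates in one chart. -/
theorem ext_coord [CompleteSpace Y] {z z' : Jet X Y π k} (hz : z.target ∈ c.total.source)
    (hz' : z'.target ∈ c.total.source) (h : coord c z = coord c z') : z = z' := by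
  have ht : z.target = z'.target := by rw [← symm_toTotal hz, h, symm_toTotal hz']
  have hb : z.base = z'.base := by rw [← proj_target z, ht]; exact proj_target z'
  have hall : ∀ c' : FiberedChart X Y π, z.target ∈ c'.total.source → coord c' z = coord c' z' := by
    intro c' h1
    have h1' : z'.target ∈ c'.total.source := ht ▸ h1
    rw [coord_eq_jetTransition hz h1, h, coord_eq_jetTransition hz' h1']
  obtain ⟨s, p, hp, rfl⟩ := z.exists_section
  obtain ⟨t, q, hq, rfl⟩ := z'.exists_section
  refine Quotient.sound ⟨hb, ht, fun c' h1 => ?_⟩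
  have := hall c' h1
  have h1' : t.toFun q ∈ c'.total.source := by
    rw [← target_jet t q hq (k := k), ← ht]; exact h1
  rwa [coord_jet s p hp h1, coord_jet t q hq h1'] at this

theorem isOpen_coord_preimage (c : FiberedChart X Y π) {O : Set (JetCoord X Y k)} (hO : IsOpen O) :
    IsOpen {z : Jet X Y π k | z.target ∈ c.total.source ∧ coord c z ∈ O} :=
  TopologicalSpace.isOpen_generateFrom_of_mem ⟨c, O, hO, rfl⟩

theorem isOpen_target_mem_source (c : FiberedChart X Y π) :
    IsOpen {z : Jet X Y π k | z.target ∈ c.total.source} := by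
  simpa using isOpen_coord_preimage (k := k) c isOpen_univ

theorem continuousAt_coord {z : Jet X Y π k} (hz : z.target ∈ c.total.source) :
    ContinuousAt (coord c : Jet X Y π k → _) z := by
  intro N hN
  obtain ⟨O, hON, hO, hzO⟩ := mem_nhds_iff.1 hN
  have h : {z : Jet X Y π k | z.target ∈ c.total.source ∧ coord c z ∈ O} ∈ 𝓝 z :=
    (isOpen_coord_preimage c hO).mem_nhds ⟨hz, hzO⟩
  exact Filter.mem_map.2 (Filter.mem_of_superset h fun w hw => hON hw.2)

/-- Jet coordinates are homeomorphisms onto their images. -/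
theorem isInducing_coord [CompleteSpace Y] (c : FiberedChart X Y π) :
    Topology.IsInducing
      (fun z : {z : Jet X Y π k | z.target ∈ c.total.source} => coord c (z : Jet X Y π k)) := by
  rw [Topology.isInducing_iff_nhds]
  rintro ⟨z, hz⟩
  have hz : z.target ∈ c.total.source := hz
  refine le_antisymm ?_ ?_
  · rw [← tendsto_iff_comap]
    exact (continuousAt_coord hz).comp continuousAt_subtype_val
  · have e : 𝓝 z = _ := TopologicalSpace.nhds_generateFrom
    rw [nhds_subtype_eq_comap, e]
    simp only [comap_iInf]
    refine le_iInf₂ ?_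
    rintro S ⟨hzS, c', O, hO, rfl⟩
    rw [comap_principal, le_principal_iff, mem_comap]
    -- A subbasic set coming from another chart is, in the coordinates of `c`, the preimage of `O`
    -- under the continuous change of coordinates, near the point.
    have h1 : ∀ᶠ ζ in 𝓝 (coord c z), ζ.toTotal ∈ c.total.target ∧
        c.total.symm ζ.toTotal ∈ c'.total.source := by
      have h0 := JetCoord.continuous_toTotal.continuousAt (x := coord c z)
      refine (h0.eventually (c.total.open_target.mem_nhds (toTotal_mem hz))).and ?_
      refine (ContinuousAt.comp (g := c.total.symm)
        (c.total.continuousAt_symm (toTotal_mem hz)) h0).eventually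
        (c'.total.open_source.mem_nhds ?_)
      rw [Function.comp_apply, symm_toTotal hz]
      exact hzS.1
    have h2 : ∀ᶠ ζ in 𝓝 (coord c z), jetTransition c c' k ζ ∈ O := by
      refine (contDiffAt_jetTransition_coord hz hzS.1).continuousAt.eventually (hO.mem_nhds ?_)
      rw [← coord_eq_jetTransition hz hzS.1]
      exact hzS.2
    refine ⟨_, h1.and h2, ?_⟩
    rintro ⟨w, hw⟩ ⟨⟨_, hw1⟩, hw2⟩
    have hw : w.target ∈ c.total.source := hw
    have hw1 : c.total.symm (coord c w).toTotal ∈ c'.total.source := hw1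
    have hw2 : jetTransition c c' k (coord c w) ∈ O := hw2
    rw [symm_toTotal hw] at hw1
    rw [← coord_eq_jetTransition hw hw1] at hw2
    exact ⟨hw1, hw2⟩

section Topology

variable [FiniteDimensional ℝ X] [FiniteDimensional ℝ Y] [IsManifold 𝓘(ℝ, X × Y) ∞ E]

theorem continuous_target (hπ : IsFibered X (X × Y) π) :
    Continuous (target : Jet X Y π k → E) := by
  rw [continuous_iff_continuousAt]
  intro z N hN
  obtain ⟨c, hc⟩ := hπ.exists_fiberedChart z.target
  have h1 : ∀ᶠ w in 𝓝 z, c.total.symm (coord c w).toTotal ∈ N := by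
    have h2 : ContinuousAt (fun w : Jet X Y π k => c.total.symm (coord c w).toTotal) z :=
      ContinuousAt.comp (g := c.total.symm)
        (c.total.continuousAt_symm (toTotal_mem hc))
        (JetCoord.continuous_toTotal.continuousAt.comp (continuousAt_coord hc))
    refine h2 ?_
    simp only [symm_toTotal hc]
    exact hN
  have h2 : ∀ᶠ w in 𝓝 z, w.target ∈ c.total.source := (isOpen_target_mem_source c).mem_nhds hc
  have h3 : ∀ᶠ w in 𝓝 z, w.target ∈ N := by
    filter_upwards [h1, h2] with w hw hw'
    rwa [symm_toTotal hw'] at hw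
  exact h3

/-- Jets with different targets are separated in `E`, jets with the same target by their coordinates
in one chart. Together with second countability this provides partitions of unity on H. -/
theorem t2Space [T2Space E] (hπ : IsFibered X (X × Y) π) : T2Space (Jet X Y π k) := by
  refine ⟨fun z z' hne => ?_⟩
  by_cases ht : z.target = z'.target
  · obtain ⟨c, hc⟩ := hπ.exists_fiberedChart z.target
    have hc' : z'.target ∈ c.total.source := ht ▸ hc
    have : coord c z ≠ coord c z' := fun h => hne (ext_coord hc hc' h)
    obtain ⟨U, V, hU, hV, hzU, hzV, hd⟩ := t2_separation this
    refine ⟨_, _, isOpen_coord_preimage c hU, isOpen_coord_preimage c hV, ⟨hc, hzU⟩, ⟨hc', hzV⟩, ?_⟩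
    exact Set.disjoint_left.2 fun w hw hw' => Set.disjoint_left.1 hd hw.2 hw'.2
  · exact separated_by_continuous (continuous_target hπ) ht

/-- Countably many fibered charts cover `E`, and over each of them the jets embed in a
finite-dimensional space. -/
theorem secondCountableTopology [SecondCountableTopology E] (hπ : IsFibered X (X × Y) π) :
    SecondCountableTopology (Jet X Y π k) := by
  choose c hc using hπ.exists_fiberedChart
  obtain ⟨t, ht, hcover⟩ := TopologicalSpace.countable_cover_nhds
    (f := fun q => (c q).total.source) fun q => (c q).total.open_source.mem_nhds (hc q)
  have : Countable t := ht.to_subtype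
  have hsc : ∀ q : t, SecondCountableTopology
      {z : Jet X Y π k | z.target ∈ (c (q : E)).total.source} := fun q => by
    have : SecondCountableTopology (JetCoord X Y k) :=
      secondCountable_of_proper
    exact (isInducing_coord (c (q : E))).secondCountableTopology
  refine TopologicalSpace.secondCountableTopology_of_countable_cover
    (U := fun q : t => {z : Jet X Y π k | z.target ∈ (c (q : E)).total.source})
    (fun q => isOpen_target_mem_source _) ?_
  rw [eq_univ_iff_forall]
  intro z
  have : z.target ∈ ⋃ q ∈ t, (c q).total.source := hcover ▸ mem_univ _
  obtain ⟨q, hq, hz⟩ := mem_iUnion₂.1 this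
  exact mem_iUnion.2 ⟨⟨q, hq⟩, hz⟩

end Topology

end Jet

end JetSpace

/-! ### Horizontal planes and total derivatives. -/

section TotalDerivative

open Set Filter

variable {X Y : Type*} [NormedAddCommGroup X] [NormedSpace ℝ X]
  [NormedAddCommGroup Y] [NormedSpace ℝ Y]

theorem IsSymmetric.cons_cons {n : ℕ} {f : X [×(n + 2)]→L[ℝ] Y} (hf : IsSymmetric f) (v w : X)
    (u : Fin n → X) : f (Fin.cons v (Fin.cons w u)) = f (Fin.cons w (Fin.cons v u)) := by
  rw [← hf (Equiv.swap 0 1) (Fin.cons w (Fin.cons v u))]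
  congr 1
  ext i
  refine Fin.cases (by simp) (fun i => Fin.cases (by simp) (fun i => ?_) i) i
  simp only [Function.comp_apply, Fin.cons_succ]
  rw [Equiv.swap_apply_of_ne_of_ne]
  · rfl
  · exact Fin.succ_ne_zero _
  · exact fun h => Fin.succ_ne_zero _ (Fin.succ_injective _ h)

namespace JetCoord

/-- The horizontal plane `v ↦ (v, y₁(v), …, y_{k+1}(v))` in the space of `k`-jet coordinates which
is determined by `(k+1)`-jet coordinates. -/
def totalDeriv {k : ℕ} (ζ : JetCoord X Y (k + 1)) : X →L[ℝ] JetCoord X Y k :=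
  (ContinuousLinearMap.id ℝ X).prod
    (ContinuousLinearMap.pi fun j : Fin (k + 1) => curryFirst X Y j (ζ.2 j.succ))

theorem totalDeriv_apply_snd {k : ℕ} (ζ : JetCoord X Y (k + 1)) (v : X) (j : Fin (k + 1)) :
    (totalDeriv ζ v).2 j = curryFirst X Y j (ζ.2 j.succ) v := rfl

/-- The lower part of a plane does not see the derivatives of highest order. Hence the plane of a
(k+2)-jet over ε(h) projects to the plane of ε(h), whichever prolongation is chosen. -/
theorem truncate_comp_totalDeriv {k : ℕ} (ζ : JetCoord X Y (k + 2)) :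
    truncate X Y k ∘L totalDeriv ζ = totalDeriv (truncate X Y (k + 1) ζ) := rfl

/-- The linear part of `ζ ↦ totalDeriv ζ`. -/
def totalDerivLin (X Y : Type*) [NormedAddCommGroup X] [NormedSpace ℝ X] [FiniteDimensional ℝ X]
    [NormedAddCommGroup Y] [NormedSpace ℝ Y] [FiniteDimensional ℝ Y] (k : ℕ) :
    JetCoord X Y (k + 1) →L[ℝ] X →L[ℝ] JetCoord X Y k :=
  LinearMap.toContinuousLinearMap
    { toFun := fun ζ => (0 : X →L[ℝ] X).prod
        (ContinuousLinearMap.pi fun j : Fin (k + 1) => curryFirst X Y j (ζ.2 j.succ))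
      map_add' := fun ζ ζ' => by
        ext v
        · simp
        · rfl
      map_smul' := fun a ζ => by
        ext v
        · simp
        · rfl }

variable [FiniteDimensional ℝ X] [FiniteDimensional ℝ Y]

/-- The plane is affine in the jet coordinates, so its derivative is the constant `totalDerivLin`.
-/
theorem totalDeriv_eq {k : ℕ} (ζ : JetCoord X Y (k + 1)) :
    totalDeriv ζ = ContinuousLinearMap.inl ℝ X _ + totalDerivLin X Y k ζ := by
  ext v : 1
  refine Prod.ext ?_ (funext fun j => ?_)
  · change v = v + 0
    rw [add_zero]
  · change curryFirst X Y j (ζ.2 j.succ) v = 0 + curryFirst X Y j (ζ.2 j.succ) v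
    rw [zero_add]

theorem contDiff_totalDeriv (k : ℕ) {n : WithTop ℕ∞} :
    ContDiff ℝ n (totalDeriv : JetCoord X Y (k + 1) → _) := by
  rw [funext totalDeriv_eq]
  exact contDiff_const.add (ContinuousLinearMap.contDiff (𝕜 := ℝ) (E := JetCoord X Y (k + 1))
    (F := X →L[ℝ] JetCoord X Y k) (totalDerivLin X Y k))

theorem hasFDerivAt_totalDeriv {k : ℕ} (ζ : JetCoord X Y (k + 1)) :
    HasFDerivAt (totalDeriv : JetCoord X Y (k + 1) → _) (totalDerivLin X Y k) ζ := by
  rw [funext totalDeriv_eq]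
  exact HasFDerivAt.const_add (𝕜 := ℝ) (E := JetCoord X Y (k + 1)) (F := X →L[ℝ] JetCoord X Y k)
    (f := totalDerivLin X Y k) (f' := totalDerivLin X Y k) _ (ContinuousLinearMap.hasFDerivAt (𝕜 := ℝ)
    (E := JetCoord X Y (k + 1)) (F := X →L[ℝ] JetCoord X Y k) (totalDerivLin X Y k))

/-- Second total derivatives commute. -/
theorem totalDerivLin_totalDeriv_comm {k : ℕ} {ζ : JetCoord X Y (k + 2)}
    (hζ : ∀ j, IsSymmetric (ζ.2 j)) (v w : X) :
    totalDerivLin X Y k (totalDeriv ζ v) w = totalDerivLin X Y k (totalDeriv ζ w) v := by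
  refine Prod.ext rfl (funext fun j => ?_)
  ext u
  change ζ.2 j.succ.succ (Fin.cons v (Fin.cons w u)) = ζ.2 j.succ.succ (Fin.cons w (Fin.cons v u))
  exact (hζ j.succ.succ).cons_cons (n := (j : ℕ)) v w u

end JetCoord

variable {M E : Type*} [TopologicalSpace M] [ChartedSpace X M]
  [TopologicalSpace E] [ChartedSpace (X × Y) E] {π : E → M}

/-- The coordinate form of the inclusion of (k+1)-jets into 1-jets of sections of the k-jets. -/
theorem LocalSection.hasFDerivAt_prolongRep (s : LocalSection X (X × Y) π) {c : FiberedChart X Y π}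
    (k : ℕ) {x : X} (h : ContDiffAt ℝ ∞ (s.rep c) x) :
    HasFDerivAt (s.prolongRep c k) (JetCoord.totalDeriv (s.prolongRep c (k + 1) x)) x := by
  refine (hasFDerivAt_id x).prodMk (hasFDerivAt_pi.2 fun j => ?_)
  have hd : DifferentiableAt ℝ (iteratedFDeriv ℝ (j : ℕ) (s.rep c)) x :=
    h.differentiableAt_iteratedFDeriv (by exact_mod_cast ENat.natCast_lt_top _)
  exact hd.hasFDerivAt

/-- A map to the space of jet coordinates which is tangent to the horizontal planes is a prolonged
map. -/
theorem iteratedFDeriv_of_holonomic {k : ℕ} {f : X → JetCoord X Y (k + 1)} {U : Set X}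
    (hU : IsOpen U) (hf : ∀ x ∈ U, ∀ j : Fin (k + 1),
      HasFDerivAt (fun x => (f x).2 j.castSucc) (curryFirst X Y j ((f x).2 j.succ)) x) :
    ∀ (j : ℕ) (hj : j < k + 2), ∀ x ∈ U,
      iteratedFDeriv ℝ j (fun x => (f x).2 0 fun i => i.elim0) x = (f x).2 ⟨j, hj⟩ := by
  intro j
  induction j with
  | zero =>
    intro hj x _
    ext v
    rw [iteratedFDeriv_zero_apply]
    change (f x).2 0 _ = (f x).2 0 v
    congr 1
    ext i
    exact i.elim0
  | succ j ih =>
    intro hj x hx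
    rw [iteratedFDeriv_succ_eq_curryFirst_symm]
    have hev : iteratedFDeriv ℝ j (fun x => (f x).2 0 fun i => i.elim0) =ᶠ[𝓝 x]
        fun x => (f x).2 (⟨j, by omega⟩ : Fin (k + 1)).castSucc :=
      Filter.mem_of_superset (hU.mem_nhds hx) fun y hy => ih (by omega) y hy
    rw [Function.comp_apply, hev.fderiv_eq, (hf x hx ⟨j, by omega⟩).fderiv]
    exact (curryFirst X Y j).symm_apply_apply _

end TotalDerivative

/-! ### A smooth inverse function theorem. -/

section InverseFunction

open Set Filter

variable {V W : Type*} [NormedAddCommGroup V] [NormedSpace ℝ V] [CompleteSpace V]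
  [NormedAddCommGroup W] [NormedSpace ℝ W]

/-- Inverse function theorem for a smooth map on an open set, with a smooth local inverse. -/
theorem exists_smooth_localInverse {f : V → W} {O : Set V} (hO : IsOpen O)
    (hf : ContDiffOn ℝ ∞ f O) {x : V} (hx : x ∈ O) (e : V ≃L[ℝ] W)
    (he : fderiv ℝ f x = (e : V →L[ℝ] W)) :
    ∃ g : OpenPartialHomeomorph V W, x ∈ g.source ∧ g.source ⊆ O ∧ (g : V → W) = f ∧
      ContDiffOn ℝ ∞ g.symm g.target := by
  have hfx := hf.contDiffAt (hO.mem_nhds hx)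
  have hd : HasFDerivAt f (e : V →L[ℝ] W) x := he ▸ (hfx.differentiableAt (by simp)).hasFDerivAt
  let g₀ := hfx.toOpenPartialHomeomorph f hd (by simp)
  -- Restriction to the open set where the derivative is invertible makes the inverse smooth on its
  -- whole target, not only at one point.
  let S : Set V := O ∩ fderiv ℝ f ⁻¹' range ((↑) : (V ≃L[ℝ] W) → V →L[ℝ] W)
  have hS : IsOpen S := (hf.continuousOn_fderiv_of_isOpen hO (by simp)).isOpen_inter_preimage hO
    ContinuousLinearEquiv.isOpen
  refine ⟨g₀.restrOpen S hS, ⟨hfx.mem_toOpenPartialHomeomorph_source hd (by simp), hx, e, he.symm⟩,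
    fun y hy => hy.2.1, rfl, fun y hy => ?_⟩
  have hy' := (g₀.restrOpen S hS).map_target hy
  obtain ⟨hyO, e', he'⟩ := hy'.2
  have h1 := hf.contDiffAt (hO.mem_nhds hyO)
  refine ((g₀.restrOpen S hS).contDiffAt_symm hy (f₀' := e') ?_ h1).contDiffWithinAt
  rw [he']
  exact (h1.differentiableAt (by simp)).hasFDerivAt

end InverseFunction

/-! ### Charts of H that are linear in jet coordinates. -/

section AdaptedChart

open Set Filter

variable {X Y Z : Type*} [NormedAddCommGroup X] [NormedSpace ℝ X] [FiniteDimensional ℝ X]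
  [NormedAddCommGroup Y] [NormedSpace ℝ Y] [FiniteDimensional ℝ Y]
  [NormedAddCommGroup Z] [NormedSpace ℝ Z] [FiniteDimensional ℝ Z]
  {M E : Type*} [TopologicalSpace M] [ChartedSpace X M]
  [TopologicalSpace E] [ChartedSpace (X × Y) E] {π : E → M}
  {k : ℕ} {H : Set (Jet X Y π k)} [ChartedSpace Z H]

/-- A chart of the submanifold `H` which is the restriction of a linear map in jet coordinates. -/
structure AdaptedChart (Z : Type*) [NormedAddCommGroup Z] [NormedSpace ℝ Z]
    {k : ℕ} (H : Set (Jet X Y π k)) [ChartedSpace Z H] where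
  fibered : FiberedChart X Y π
  lin : JetCoord X Y k →L[ℝ] Z
  chart : OpenPartialHomeomorph H Z
  chart_mem : chart ∈ IsManifold.maximalAtlas 𝓘(ℝ, Z) ∞ H
  target_mem : ∀ h ∈ chart.source, (h : Jet X Y π k).target ∈ fibered.total.source
  chart_apply : ∀ h ∈ chart.source, chart h = lin (Jet.coord fibered (h : Jet X Y π k))

/-- A linear left inverse of the differential of the inclusion, composed with the inclusion, has
derivative the identity at the point. By the inverse function theorem it is a local diffeomorphism,
hence a chart. Linearity allows derivatives along H to be read off from derivatives of jet
coordinates. -/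
theorem IsImmersionToJet.exists_adaptedChart [IsManifold 𝓘(ℝ, Z) ∞ H]
    (hH : IsImmersionToJet Z (fun h : H => (h : Jet X Y π k))) (h₀ : H) (c : FiberedChart X Y π)
    (hc : (h₀ : Jet X Y π k).target ∈ c.total.source) :
    ∃ a : AdaptedChart Z H, a.fibered = c ∧ h₀ ∈ a.chart.source := by
  set e := chartAt Z h₀ with he
  have hU : IsOpen {h : H | (h : Jet X Y π k).target ∈ c.total.source} :=
    (Jet.isOpen_target_mem_source c).preimage continuous_subtype_val
  have hsm := hH.1.2 c
  set O : Set Z := e.target ∩ e.symm ⁻¹' {h : H | (h : Jet X Y π k).target ∈ c.total.source} with hO'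
  have hO : IsOpen O := e.isOpen_inter_preimage_symm hU
  have hemem : e ∈ IsManifold.maximalAtlas 𝓘(ℝ, Z) ∞ H := IsManifold.chart_mem_maximalAtlas h₀
  have hf : ContDiffOn ℝ ∞ (fun z => Jet.coord c (e.symm z : Jet X Y π k)) O := by
    rw [← contMDiffOn_iff_contDiffOn]
    exact hsm.comp ((contMDiffOn_symm_of_mem_maximalAtlas hemem).mono inter_subset_left)
      fun z hz => hz.2
  have hx : e h₀ ∈ O := ⟨mem_chart_target Z h₀, by
    change ((e.symm (e h₀) : H) : Jet X Y π k).target ∈ c.total.source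
    rwa [e.left_inv (mem_chart_source Z h₀)]⟩
  have hfx := (hf.contDiffAt (hO.mem_nhds hx)).differentiableAt (by simp)
  have hinj : Function.Injective
      (fderiv ℝ (fun z => Jet.coord c (e.symm z : Jet X Y π k)) (e h₀)) := by
    have h1 : Function.Injective (mfderiv 𝓘(ℝ, Z) 𝓘(ℝ, JetCoord X Y k)
        (fun h : H => Jet.coord c (h : Jet X Y π k)) h₀) := hH.2 c h₀ hc
    have hmd : MDifferentiableAt 𝓘(ℝ, Z) 𝓘(ℝ, JetCoord X Y k)
        (fun h : H => Jet.coord c (h : Jet X Y π k)) h₀ :=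
      (hsm.contMDiffAt (hU.mem_nhds hc)).mdifferentiableAt (by simp)
    rw [hmd.mfderiv] at h1
    simp only [writtenInExtChartAt, fderivWithin_univ, Function.comp_def, mfld_simps] at h1
    exact h1
  obtain ⟨L₀, hL₀⟩ := LinearMap.exists_leftInverse_of_injective
    (fderiv ℝ (fun z => Jet.coord c (e.symm z : Jet X Y π k)) (e h₀)).toLinearMap
    (LinearMap.ker_eq_bot.2 hinj)
  set L : JetCoord X Y k →L[ℝ] Z := LinearMap.toContinuousLinearMap L₀
  have hLd : fderiv ℝ (fun z => L (Jet.coord c (e.symm z : Jet X Y π k))) (e h₀) =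
      ((ContinuousLinearEquiv.refl ℝ Z : Z ≃L[ℝ] Z) : Z →L[ℝ] Z) := by
    have := (L.hasFDerivAt.comp (e h₀) hfx.hasFDerivAt).fderiv
    rw [Function.comp_def] at this
    rw [this]
    ext z
    exact DFunLike.congr_fun hL₀ z
  have : CompleteSpace Z := FiniteDimensional.complete ℝ Z
  obtain ⟨g, hxg, hgO, hgf, hgs⟩ := exists_smooth_localInverse hO
    (L.contDiff.comp_contDiffOn hf) hx (ContinuousLinearEquiv.refl ℝ Z) hLd
  have hgd : ContDiffOn ℝ ∞ g g.source := by
    rw [hgf]; exact (L.contDiff.comp_contDiffOn hf).mono hgO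
  have hsrc : ∀ h ∈ (e.trans g).source, h ∈ e.source ∧ e h ∈ g.source := fun h hh => by
    simpa using hh
  refine ⟨⟨c, L, e.trans g, ?_, ?_, ?_⟩, rfl, ?_⟩
  · refine OpenPartialHomeomorph.mem_maximalAtlas_of_contMDiffOn _ ?_ ?_
    · exact (contMDiffOn_iff_contDiffOn.2 hgd).comp
        ((contMDiffOn_of_mem_maximalAtlas hemem).mono fun h hh => (hsrc h hh).1)
        fun h hh => (hsrc h hh).2
    · refine (contMDiffOn_symm_of_mem_maximalAtlas hemem).comp
        ((contMDiffOn_iff_contDiffOn.2 hgs).mono fun z hz => ?_) fun z hz => ?_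
      · simp only [OpenPartialHomeomorph.trans_target] at hz; exact hz.1
      · simp only [OpenPartialHomeomorph.trans_target] at hz; exact hz.2
  · intro h hh
    have h1 := (hgO (hsrc h hh).2).2
    change ((e.symm (e h) : H) : Jet X Y π k).target ∈ c.total.source at h1
    rwa [e.left_inv (hsrc h hh).1] at h1
  · intro h hh
    change g (e h) = _
    rw [hgf]
    change L (Jet.coord c (e.symm (e h) : Jet X Y π k)) = _
    rw [e.left_inv (hsrc h hh).1]
  · simpa using ⟨mem_chart_source Z h₀, hxg⟩

end AdaptedChart

/-! ### The plane field of ε and 1-jets in charts. -/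

section Prolongation

open Set Filter

variable {X Y Z : Type*} [NormedAddCommGroup X] [NormedSpace ℝ X] [FiniteDimensional ℝ X]
  [NormedAddCommGroup Y] [NormedSpace ℝ Y] [FiniteDimensional ℝ Y]
  [NormedAddCommGroup Z] [NormedSpace ℝ Z] [FiniteDimensional ℝ Z]
  {M E : Type*} [TopologicalSpace M] [ChartedSpace X M]
  [TopologicalSpace E] [ChartedSpace (X × Y) E] {π : E → M}
  {k : ℕ} {H : Set (Jet X Y π k)} [ChartedSpace Z H] {ε : H → Jet X Y π (k + 1)}

theorem IsJetSection.target_eq (hε : IsJetSection Z ε) (h : H) :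
    (ε h).target = (h : Jet X Y π k).target := by
  rw [← hε.proj_apply h, Jet.target_proj]

theorem IsJetSection.base_eq (hε : IsJetSection Z ε) (h : H) :
    (ε h).base = (h : Jet X Y π k).base := by
  rw [← hε.proj_apply h, Jet.base_proj]

theorem IsJetSection.injective (hε : IsJetSection Z ε) : Function.Injective ε := fun h h' e =>
  Subtype.ext (by rw [← hε.proj_apply h, ← hε.proj_apply h', e])

/-- Over `ζ`, the linear map `B` is the horizontal plane of some second order prolongation of `ζ`:
it comes from symmetric jet coordinates of one order more. -/
def IsHolonomicPlane {m : ℕ} (ζ : JetCoord X Y (m + 1)) (B : X →L[ℝ] JetCoord X Y (m + 1)) : Prop :=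
  ∃ ζ' : JetCoord X Y (m + 2), (∀ j, IsSymmetric (ζ'.2 j)) ∧
    JetCoord.truncate X Y (m + 1) ζ' = ζ ∧ B = JetCoord.totalDeriv ζ'

namespace AdaptedChart

variable (a : AdaptedChart Z H)

/-- The section `ε` in an adapted chart of `H` and in jet coordinates. -/
def jetMap (ε : H → Jet X Y π (k + 1)) (w : Z) : JetCoord X Y (k + 1) :=
  Jet.coord a.fibered (ε (a.chart.symm w))

/-- The horizontal planes which `ε` singles out, in an adapted chart of `H`. -/
def slope (ε : H → Jet X Y π (k + 1)) (w : Z) : X →L[ℝ] Z :=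
  a.lin ∘L JetCoord.totalDeriv (a.jetMap ε w)

variable {a}

theorem target_mem_symm (hε : IsJetSection Z ε) {w : Z} (hw : w ∈ a.chart.target) :
    (ε (a.chart.symm w)).target ∈ a.fibered.total.source := by
  rw [hε.target_eq]
  exact a.target_mem _ (a.chart.map_target hw)

theorem contDiffOn_jetMap (hε : IsJetSection Z ε) :
    ContDiffOn ℝ ∞ (a.jetMap ε) a.chart.target := by
  rw [← contMDiffOn_iff_contDiffOn]
  exact (hε.smooth.2 a.fibered).comp (contMDiffOn_symm_of_mem_maximalAtlas a.chart_mem)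
    fun w hw => target_mem_symm hε hw

theorem contDiffAt_jetMap (hε : IsJetSection Z ε) {w : Z} (hw : w ∈ a.chart.target) :
    ContDiffAt ℝ ∞ (a.jetMap ε) w :=
  (contDiffOn_jetMap hε).contDiffAt (a.chart.open_target.mem_nhds hw)

theorem hasFDerivAt_jetMap (hε : IsJetSection Z ε) {w : Z} (hw : w ∈ a.chart.target) :
    HasFDerivAt (a.jetMap ε) (fderiv ℝ (a.jetMap ε) w) w :=
  ((contDiffAt_jetMap hε hw).differentiableAt (by simp)).hasFDerivAt

theorem truncate_jetMap (hε : IsJetSection Z ε) {w : Z} (hw : w ∈ a.chart.target) :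
    JetCoord.truncate X Y k (a.jetMap ε w) =
      Jet.coord a.fibered (a.chart.symm w : Jet X Y π k) := by
  rw [jetMap, ← Jet.coord_proj (target_mem_symm hε hw), hε.proj_apply]

theorem lin_truncate_jetMap (hε : IsJetSection Z ε) {w : Z} (hw : w ∈ a.chart.target) :
    a.lin (JetCoord.truncate X Y k (a.jetMap ε w)) = w := by
  rw [truncate_jetMap hε hw, ← a.chart_apply _ (a.chart.map_target hw), a.chart.right_inv hw]

/-- Differentiating `lin_truncate_jetMap` shows that `a.lin` after truncation is a left inverse of
the differential of ε. With it the derivative of σ is recovered from that of ε ∘ σ. -/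
theorem lin_truncate_fderiv_jetMap (hε : IsJetSection Z ε) {w : Z} (hw : w ∈ a.chart.target)
    (u : Z) : a.lin (JetCoord.truncate X Y k (fderiv ℝ (a.jetMap ε) w u)) = u := by
  have h1 : HasFDerivAt (fun w => a.lin (JetCoord.truncate X Y k (a.jetMap ε w)))
      (a.lin ∘L JetCoord.truncate X Y k ∘L fderiv ℝ (a.jetMap ε) w) w :=
    a.lin.hasFDerivAt.comp w ((JetCoord.truncate X Y k).hasFDerivAt.comp w
      (hasFDerivAt_jetMap hε hw))
  have h2 : (fun w => a.lin (JetCoord.truncate X Y k (a.jetMap ε w))) =ᶠ[𝓝 w] id :=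
    Filter.mem_of_superset (a.chart.open_target.mem_nhds hw) fun w hw => lin_truncate_jetMap hε hw
  exact DFunLike.congr_fun (h1.unique ((hasFDerivAt_id w).congr_of_eventuallyEq h2)) u

theorem jetMap_chart {h : H} (hh : h ∈ a.chart.source) :
    a.jetMap ε (a.chart h) = Jet.coord a.fibered (ε h) := by
  rw [jetMap, a.chart.left_inv hh]

theorem contDiffOn_slope (hε : IsJetSection Z ε) :
    ContDiffOn ℝ ∞ (a.slope ε) a.chart.target := by
  have h1 : ContDiffOn ℝ ∞ (fun w => JetCoord.totalDeriv (a.jetMap ε w)) a.chart.target :=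
    (JetCoord.contDiff_totalDeriv k).comp_contDiffOn (contDiffOn_jetMap hε)
  exact contDiffOn_const.clm_comp h1

/-- Because the adapted chart is linear and `totalDeriv` affine in jet coordinates, no derivative
other than that of ε appears. -/
theorem fderiv_slope_apply (hε : IsJetSection Z ε) {w : Z} (hw : w ∈ a.chart.target) (u : Z)
    (v : X) : fderiv ℝ (a.slope ε) w u v =
      a.lin (JetCoord.totalDerivLin X Y k (fderiv ℝ (a.jetMap ε) w u) v) := by
  have h1 : HasFDerivAt (fun w => JetCoord.totalDeriv (a.jetMap ε w))
      ((JetCoord.totalDerivLin X Y k).comp (fderiv ℝ (a.jetMap ε) w)) w := by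
    have h0 := JetCoord.hasFDerivAt_totalDeriv (a.jetMap ε w)
    exact HasFDerivAt.comp (𝕜 := ℝ) (E := Z) (F := JetCoord X Y (k + 1))
      (G := X →L[ℝ] JetCoord X Y k) (f := a.jetMap ε) (f' := fderiv ℝ (a.jetMap ε) w)
      (g := fun ζ => JetCoord.totalDeriv ζ) (g' := JetCoord.totalDerivLin X Y k) w h0
      (hasFDerivAt_jetMap hε hw)
  have h2 := (hasFDerivAt_const a.lin w).clm_comp h1
  have h3 : HasFDerivAt (a.slope ε) _ w := h2
  rw [h3.fderiv]
  simp

/-- If all the jets of `ε` can be prolonged, the planes of `ε` satisfy Frobenius' condition. -/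
theorem fderiv_slope_symm (hε : IsJetSection Z ε) {w : Z} (hw : w ∈ a.chart.target)
    (hp : IsHolonomicPlane (a.jetMap ε w) (fderiv ℝ (a.jetMap ε) w ∘L a.slope ε w)) (u v : X) :
    fderiv ℝ (a.slope ε) w (a.slope ε w u) v = fderiv ℝ (a.slope ε) w (a.slope ε w v) u := by
  obtain ⟨ζ', hsymm, _, hB⟩ := hp
  have hB' : ∀ v, fderiv ℝ (a.jetMap ε) w (a.slope ε w v) = JetCoord.totalDeriv ζ' v :=
    fun v => DFunLike.congr_fun hB v
  rw [fderiv_slope_apply hε hw, fderiv_slope_apply hε hw, hB', hB',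
    JetCoord.totalDerivLin_totalDeriv_comm hsymm]

end AdaptedChart

/-- A symmetric system of jet coordinates over the domain of a fibered chart belongs to a section. -/
theorem exists_section_of_isSymmetric {m : ℕ} (c : FiberedChart X Y π) (ζ : JetCoord X Y m)
    (hζ : ∀ j, IsSymmetric (ζ.2 j)) (ht : ζ.toTotal ∈ c.total.target) :
    ∃ (s : LocalSection X (X × Y) π) (_ : c.base.symm ζ.1 ∈ s.domain),
      s.toFun (c.base.symm ζ.1) ∈ c.total.source ∧ s.prolongRep c m ζ.1 = ζ := by
  have : CompleteSpace Y := FiniteDimensional.complete ℝ Y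
  have hP : ContDiff ℝ ∞ (jetPolynomial ζ) := contDiff_jetPolynomial_right ζ
  have hU : IsOpen {x : X | (x, jetPolynomial ζ x) ∈ c.total.target} :=
    c.total.open_target.preimage (continuous_id.prodMk hP.continuous)
  have hx : ζ.1 ∈ {x : X | (x, jetPolynomial ζ x) ∈ c.total.target} := by
    rw [mem_ofPred_eq, jetPolynomial_apply_self]
    exact ht
  refine ⟨c.toSection (jetPolynomial ζ) hU hP.contDiffOn fun x hx => hx,
    FiberedChart.symm_mem_toSection_domain hx, FiberedChart.toSection_mem_source hx, ?_⟩
  rw [FiberedChart.toSection_prolongRep m hx]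
  exact Prod.ext rfl (funext fun j => iteratedFDeriv_jetPolynomial ζ j (hζ j))

/-- Equality of `1`-jets can be checked in one chart. -/
theorem sameOneJet_of_fderiv_eq {m : ℕ} {s : LocalSection X (X × Y) π} {f : M → Jet X Y π m} {p : M}
    (hp : p ∈ s.domain) {c : FiberedChart X Y π} (hc : s.toFun p ∈ c.total.source)
    (hsf : s.jet m p hp = f p) (hf : ContinuousAt f p)
    (hfd : DifferentiableAt ℝ (fun x => Jet.coord c (f (c.base.symm x))) (c.base p))
    (h : fderiv ℝ (s.prolongRep c m) (c.base p) =
      fderiv ℝ (fun x => Jet.coord c (f (c.base.symm x))) (c.base p)) :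
    SameOneJet s f p hp := by
  have : CompleteSpace Y := FiniteDimensional.complete ℝ Y
  refine ⟨hsf, fun c' hc' => ?_⟩
  have hb := s.base_mem hp hc
  have hb' := s.base_mem hp hc'
  set τ := FiberedChart.transBase c c' with hτ
  have hτp : τ (c'.base p) = c.base p := by
    rw [hτ, FiberedChart.transBase, c'.base.left_inv hb']
  have hτd : HasFDerivAt τ (fderiv ℝ τ (c'.base p)) (c'.base p) :=
    ((FiberedChart.contDiffAt_transBase (c'.base.map_source hb')
      (by rwa [c'.base.left_inv hb'])).differentiableAt (by simp)).hasFDerivAt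
  have hft : (f p).target = s.toFun p := by rw [← hsf, Jet.target_jet]
  have hΦ : HasFDerivAt (jetTransition c c' m)
      (fderiv ℝ (jetTransition c c' m) (Jet.coord c (f p))) (Jet.coord c (f p)) :=
    ((Jet.contDiffAt_jetTransition_coord (by rwa [hft]) (by rwa [hft])).differentiableAt
      (by simp)).hasFDerivAt
  have hfp : Jet.coord c (f p) = s.prolongRep c m (c.base p) := by
    rw [← hsf, Jet.coord_jet s p hp hc]
  -- Near the point both maps pass from `c` to `c'` by the same change of jet and base coordinates,
  -- so the chain rule transports the equality of derivatives.
  have e1 : s.prolongRep c' m =ᶠ[𝓝 (c'.base p)]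
      fun x => jetTransition c c' m (s.prolongRep c m (τ x)) := by
    have h1 := s.eventually_base_symm hp hc' (s.eventually_mem hp hc)
    have h2 := s.eventually_base_symm hp hc' (s.eventually_mem hp hc')
    filter_upwards [h1, h2, c'.base.open_target.mem_nhds (c'.base.map_source hb')] with x h1 h2 h3
    have := s.prolongRep_eq_jetTransition m h1.1 h1.2 h2.2
    rwa [c'.base.right_inv h3] at this
  have e2 : (fun x => Jet.coord c' (f (c'.base.symm x))) =ᶠ[𝓝 (c'.base p)]
      fun x => jetTransition c c' m (Jet.coord c (f (c.base.symm (τ x)))) := by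
    have h1 : ∀ᶠ q in 𝓝 p, (f q).target ∈ c.total.source := hf.preimage_mem_nhds
      ((Jet.isOpen_target_mem_source c).mem_nhds (by rwa [mem_ofPred_eq, hft]))
    have h2 : ∀ᶠ q in 𝓝 p, (f q).target ∈ c'.total.source := hf.preimage_mem_nhds
      ((Jet.isOpen_target_mem_source c').mem_nhds (by rwa [mem_ofPred_eq, hft]))
    have h3 : ∀ᶠ q in 𝓝 p, q ∈ c.base.source := c.base.open_source.mem_nhds hb
    filter_upwards [s.eventually_base_symm hp hc' h1, s.eventually_base_symm hp hc' h2,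
      s.eventually_base_symm hp hc' h3] with x h1 h2 h3
    rw [Jet.coord_eq_jetTransition h1 h2, hτ, FiberedChart.transBase, c.base.left_inv h3]
  have d1 : HasFDerivAt (s.prolongRep c m) (fderiv ℝ (s.prolongRep c m) (c.base p)) (c.base p) :=
    ((s.contDiffAt_prolongRep m hp hc).differentiableAt (by simp)).hasFDerivAt
  have d2 := hfd.hasFDerivAt
  rw [e1.fderiv_eq, e2.fderiv_eq]
  have k1 : HasFDerivAt (fun x => jetTransition c c' m (s.prolongRep c m (τ x)))
      (fderiv ℝ (jetTransition c c' m) (Jet.coord c (f p)) ∘L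
        fderiv ℝ (s.prolongRep c m) (c.base p) ∘L fderiv ℝ τ (c'.base p)) (c'.base p) := by
    refine HasFDerivAt.comp (c'.base p) (g := jetTransition c c' m) ?_
      (HasFDerivAt.comp (c'.base p) (g := s.prolongRep c m) ?_ hτd)
    · rw [hτp, ← hfp]; exact hΦ
    · rw [hτp]; exact d1
  have k2 : HasFDerivAt (fun x => jetTransition c c' m (Jet.coord c (f (c.base.symm (τ x)))))
      (fderiv ℝ (jetTransition c c' m) (Jet.coord c (f p)) ∘L
        fderiv ℝ (fun x => Jet.coord c (f (c.base.symm x))) (c.base p) ∘L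
          fderiv ℝ τ (c'.base p)) (c'.base p) := by
    refine HasFDerivAt.comp (c'.base p) (g := jetTransition c c' m) ?_
      (HasFDerivAt.comp (c'.base p) (g := fun x => Jet.coord c (f (c.base.symm x))) ?_ hτd)
    · rw [hτp, c.base.left_inv hb]; exact hΦ
    · rw [hτp]; exact d2
  rw [k1.fderiv, k2.fderiv, h]

end Prolongation

/-! ### Prolongability of ε(h) as a condition on the plane Dε ∘ A. -/

section Curvature

open Set Filter

variable {X Y Z : Type*} [NormedAddCommGroup X] [NormedSpace ℝ X] [FiniteDimensional ℝ X]
  [NormedAddCommGroup Y] [NormedSpace ℝ Y] [FiniteDimensional ℝ Y]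
  [NormedAddCommGroup Z] [NormedSpace ℝ Z] [FiniteDimensional ℝ Z]
  {M E : Type*} [TopologicalSpace M] [ChartedSpace X M]
  [TopologicalSpace E] [ChartedSpace (X × Y) E] {π : E → M}
  {k : ℕ} {H : Set (Jet X Y π k)} [ChartedSpace Z H] {ε : H → Jet X Y π (k + 1)}

/-- A local section of `H → M`, in an adapted chart of `H`. -/
def AdaptedChart.rep (a : AdaptedChart Z H)
    (σ : LocalSection X Z (fun h : H => (h : Jet X Y π k).base)) (x : X) : Z :=
  a.chart (σ.toFun (a.fibered.base.symm x))

/-- If `ε ∘ σ` is holonomic to first order at `p`, then `σ` is tangent to the plane of `ε`. -/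
theorem SameOneJet.hasFDerivAt_rep {a : AdaptedChart Z H} (hε : IsJetSection Z ε)
    {s : LocalSection X (X × Y) π} {σ : LocalSection X Z (fun h : H => (h : Jet X Y π k).base)}
    {p : M} {hp : p ∈ s.domain} (hpσ : p ∈ σ.domain)
    (hσ : SameOneJet s (fun q => ε (σ.toFun q)) p hp) (hh : σ.toFun p ∈ a.chart.source) :
    HasFDerivAt (a.rep σ) (a.slope ε (a.chart (σ.toFun p))) (a.fibered.base p) ∧
      IsHolonomicPlane (a.jetMap ε (a.chart (σ.toFun p)))
        (fderiv ℝ (a.jetMap ε) (a.chart (σ.toFun p)) ∘L a.slope ε (a.chart (σ.toFun p))) := by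
  set c := a.fibered with hcdef
  set h := σ.toFun p with hhdef
  obtain ⟨hσ1, hσ2⟩ := hσ
  have hσ1 : s.jet (k + 1) p hp = ε h := hσ1
  have ht : (ε h).target = s.toFun p := by rw [← hσ1, Jet.target_jet]
  have hc : s.toFun p ∈ c.total.source := by
    rw [← ht, hε.target_eq]; exact a.target_mem h hh
  have hb := s.base_mem hp hc
  have hw : a.chart h ∈ a.chart.target := a.chart.map_source hh
  have hσc : ContMDiffAt 𝓘(ℝ, X) 𝓘(ℝ, Z) ∞ σ.toFun p :=
    σ.contMDiffOn.contMDiffAt (σ.isOpen_domain.mem_nhds hpσ)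
  have hrep : ContDiffAt ℝ ∞ (a.rep σ) (c.base p) := by
    rw [← contMDiffAt_iff_contDiffAt]
    have h1 : ContMDiffAt 𝓘(ℝ, X) 𝓘(ℝ, X) ∞ c.base.symm (c.base p) :=
      contMDiffAt_symm_of_mem_maximalAtlas c.base_mem (c.base.map_source hb)
    have h2 : ContMDiffAt 𝓘(ℝ, Z) 𝓘(ℝ, Z) ∞ a.chart h :=
      contMDiffAt_of_mem_maximalAtlas a.chart_mem hh
    have h3 : ContMDiffAt 𝓘(ℝ, X) 𝓘(ℝ, Z) ∞ (fun q => a.chart (σ.toFun q)) p := h2.comp p hσc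
    exact h3.comp_of_eq h1 (c.base.left_inv hb)
  have hrepd := (hrep.differentiableAt (by simp)).hasFDerivAt
  have hrep0 : a.rep σ (c.base p) = a.chart h := by
    rw [AdaptedChart.rep, ← hcdef, c.base.left_inv hb]
  have hev : (fun x => Jet.coord c (ε (σ.toFun (c.base.symm x)))) =ᶠ[𝓝 (c.base p)]
      fun x => a.jetMap ε (a.rep σ x) := by
    have h1 : ∀ᶠ q in 𝓝 p, σ.toFun q ∈ a.chart.source :=
      hσc.continuousAt.preimage_mem_nhds (a.chart.open_source.mem_nhds hh)
    filter_upwards [s.eventually_base_symm hp hc h1] with x hx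
    rw [AdaptedChart.rep, AdaptedChart.jetMap_chart hx]
  have hd1 : HasFDerivAt (fun x => a.jetMap ε (a.rep σ x))
      (fderiv ℝ (a.jetMap ε) (a.chart h) ∘L fderiv ℝ (a.rep σ) (c.base p)) (c.base p) := by
    refine HasFDerivAt.comp (c.base p) (g := a.jetMap ε) ?_ hrepd
    rw [hrep0]
    exact AdaptedChart.hasFDerivAt_jetMap hε hw
  have hd2 := s.hasFDerivAt_prolongRep (k + 1) (s.contDiffAt_rep hp hc)
  -- The first derivative of j^{k+1}s is the plane of j^{k+2}s, that of ε ∘ σ is given by the chain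
  -- rule; equality of 1-jets identifies them.
  have heq : JetCoord.totalDeriv (s.prolongRep c (k + 2) (c.base p)) =
      fderiv ℝ (a.jetMap ε) (a.chart h) ∘L fderiv ℝ (a.rep σ) (c.base p) := by
    rw [← hd1.fderiv, ← hev.fderiv_eq, ← hσ2 c hc, hd2.fderiv]
  have htr : JetCoord.truncate X Y (k + 1) (s.prolongRep c (k + 2) (c.base p)) =
      a.jetMap ε (a.chart h) := by
    rw [AdaptedChart.jetMap_chart hh, ← hσ1, Jet.coord_jet s p hp hc]
    rfl
  -- The left inverse of the differential of ε is applied to `heq`; truncation turns the plane of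
  -- the (k+2)-jet into that of ε(h), whose image under `a.lin` is the slope.
  have hslope : fderiv ℝ (a.rep σ) (c.base p) = a.slope ε (a.chart h) := by
    ext v
    rw [← AdaptedChart.lin_truncate_fderiv_jetMap hε hw (fderiv ℝ (a.rep σ) (c.base p) v)]
    have : fderiv ℝ (a.jetMap ε) (a.chart h) (fderiv ℝ (a.rep σ) (c.base p) v) =
      JetCoord.totalDeriv (s.prolongRep c (k + 2) (c.base p)) v := (DFunLike.congr_fun heq v).symm
    rw [this, AdaptedChart.slope, ← htr, ← JetCoord.truncate_comp_totalDeriv]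
    rfl
  refine ⟨hslope ▸ hrepd, s.prolongRep c (k + 2) (c.base p), fun j => ?_, htr, ?_⟩
  · exact isSymmetric_iteratedFDeriv (s.contDiffAt_rep hp hc) j
  · rw [heq, hslope]

theorem isHolonomicPlane_of_mem_image {a : AdaptedChart Z H} (hε : IsJetSection Z ε) {h : H}
    (hh : h ∈ a.chart.source) (hz : ε h ∈ Jet.proj '' prolongation Z ε) :
    IsHolonomicPlane (a.jetMap ε (a.chart h))
      (fderiv ℝ (a.jetMap ε) (a.chart h) ∘L a.slope ε (a.chart h)) := by
  obtain ⟨z, ⟨s, p, hp, rfl, σ, hpσ, hσ⟩, hz⟩ := hz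
  obtain rfl : σ.toFun p = h := hε.injective (by rw [← hz, Jet.proj_jet]; exact hσ.1.symm)
  exact (hσ.hasFDerivAt_rep hε hpσ hh).2

/-- The symmetric coordinates are those of a (k+2)-jet of some section `s`. It remains to find a
section of H → M through `h` tangent to the slope: an affine map in the adapted chart has the right
derivative but covers the identity of the base only to first order, so it is reparametrized by a
local inverse of the base map it covers. -/
theorem mem_image_of_isHolonomicPlane {a : AdaptedChart Z H} (hε : IsJetSection Z ε) {h : H}
    (hh : h ∈ a.chart.source) (hB : IsHolonomicPlane (a.jetMap ε (a.chart h))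
      (fderiv ℝ (a.jetMap ε) (a.chart h) ∘L a.slope ε (a.chart h))) :
    ε h ∈ Jet.proj '' prolongation Z ε := by
  have : CompleteSpace Y := FiniteDimensional.complete ℝ Y
  have : CompleteSpace X := FiniteDimensional.complete ℝ X
  set c := a.fibered with hcdef
  set w := a.chart h with hwdef
  have hw : w ∈ a.chart.target := a.chart.map_source hh
  have hwh : a.chart.symm w = h := a.chart.left_inv hh
  have hhc : (ε h).target ∈ c.total.source := by
    rw [hε.target_eq]; exact a.target_mem h hh
  have hζh : a.jetMap ε w = Jet.coord c (ε h) := AdaptedChart.jetMap_chart hh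
  obtain ⟨ζ', hsym, htr, hB⟩ := hB
  have ht : ζ'.toTotal ∈ c.total.target := by
    have h1 : ζ'.toTotal = (JetCoord.truncate X Y (k + 1) ζ').toTotal := rfl
    rw [h1, htr, hζh]
    exact Jet.toTotal_mem hhc
  obtain ⟨s, hp, hsrc, hrep⟩ := exists_section_of_isSymmetric c ζ' hsym ht
  have hx0 : c.base (c.base.symm ζ'.1) = ζ'.1 := c.base.right_inv (c.fst_mem_target ht)
  have hfst : (a.jetMap ε w).1 = ζ'.1 := by rw [← htr]; rfl
  set p := c.base.symm ζ'.1 with hpdef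
  set x₀ := ζ'.1 with hx₀
  have hjet : s.jet (k + 1) p hp = ε h := by
    refine Jet.ext_coord (c := c) hsrc hhc ?_
    rw [Jet.coord_jet s p hp hsrc, hx0, ← hζh, ← htr, ← hrep]
    rfl
  let ℓ : X → Z := fun x => w + a.slope ε w (x - x₀)
  have hℓ : ContDiff ℝ ∞ ℓ :=
    contDiff_const.add ((a.slope ε w).contDiff.comp (contDiff_id.sub contDiff_const))
  have hℓ0 : ℓ x₀ = w := by simp [ℓ]
  have hℓd : HasFDerivAt ℓ (a.slope ε w) x₀ :=
    ((a.slope ε w).hasFDerivAt.comp x₀ ((hasFDerivAt_id x₀).sub_const x₀)).const_add w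
  have hO : IsOpen (ℓ ⁻¹' a.chart.target) := a.chart.open_target.preimage hℓ.continuous
  have hxO : x₀ ∈ ℓ ⁻¹' a.chart.target := by rw [mem_preimage, hℓ0]; exact hw
  have hβ : ContDiffOn ℝ ∞ (fun x => (a.jetMap ε (ℓ x)).1) (ℓ ⁻¹' a.chart.target) :=
    contDiff_fst.comp_contDiffOn
      ((AdaptedChart.contDiffOn_jetMap hε).comp hℓ.contDiffOn fun x hx => hx)
  have hjd : HasFDerivAt (fun x => a.jetMap ε (ℓ x)) (JetCoord.totalDeriv ζ') x₀ := by
    rw [← hB]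
    refine HasFDerivAt.comp x₀ (g := a.jetMap ε) ?_ hℓd
    rw [hℓ0]
    exact AdaptedChart.hasFDerivAt_jetMap hε hw
  have hβd : HasFDerivAt (fun x => (a.jetMap ε (ℓ x)).1)
      ((ContinuousLinearEquiv.refl ℝ X : X ≃L[ℝ] X) : X →L[ℝ] X) x₀ := hjd.fst
  obtain ⟨g, hxg, hgO, hgf, hgs⟩ := exists_smooth_localInverse hO hβ hxO
    (ContinuousLinearEquiv.refl ℝ X) hβd.fderiv
  have hg0 : g x₀ = x₀ := by rw [hgf]; change (a.jetMap ε (ℓ x₀)).1 = x₀; rw [hℓ0, hfst]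
  have hxt : x₀ ∈ g.target := by rw [← hg0]; exact g.map_source hxg
  have hgs0 : g.symm x₀ = x₀ := by conv_lhs => rw [← hg0]
                                   exact g.left_inv hxg
  -- The reparametrization has derivative the identity at `x₀`, so the 1-jet is unchanged.
  have hgd : HasFDerivAt g.symm (ContinuousLinearMap.id ℝ X) x₀ := by
    refine g.hasFDerivAt_symm (f' := ContinuousLinearEquiv.refl ℝ X) hxt ?_
    rw [hgs0, hgf]; exact hβd
  let σ : LocalSection X Z (fun h : H => (h : Jet X Y π k).base) :=
    { domain := c.base.source ∩ c.base ⁻¹' g.target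
      isOpen_domain := c.base.isOpen_inter_preimage g.open_target
      toFun := fun q => a.chart.symm (ℓ (g.symm (c.base q)))
      contMDiffOn := by
        have h1 : ContMDiffOn 𝓘(ℝ, X) 𝓘(ℝ, Z) ∞ (fun x => a.chart.symm (ℓ (g.symm x))) g.target :=
          (contMDiffOn_symm_of_mem_maximalAtlas a.chart_mem).comp
            (contMDiffOn_iff_contDiffOn.2 (hℓ.comp_contDiffOn hgs))
            fun x hx => hgO (g.map_target hx)
        exact h1.comp ((contMDiffOn_of_mem_maximalAtlas c.base_mem).mono inter_subset_left)
          fun q hq => hq.2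
      proj_apply := by
        intro q hq
        have hy : ℓ (g.symm (c.base q)) ∈ a.chart.target := hgO (g.map_target hq.2)
        have h1 := AdaptedChart.target_mem_symm hε hy
        have h2 := Jet.coord_fst h1
        have h3 : (Jet.coord a.fibered (ε (a.chart.symm (ℓ (g.symm (c.base q)))))).1 = c.base q := by
          have := g.right_inv hq.2
          rw [hgf] at this
          exact this
        have h4 := Jet.base_mem h1
        rw [hε.base_eq] at h2 h4
        exact c.base.injOn h4 hq.1 (h2.symm.trans h3) }
  have hpb : p ∈ c.base.source := c.base.map_target (c.fst_mem_target ht)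
  have hpσ : p ∈ σ.domain := ⟨hpb, by rw [mem_preimage, hx0]; exact hxt⟩
  have hσp : σ.toFun p = h := by
    change a.chart.symm (ℓ (g.symm (c.base p))) = h
    rw [hx0, hgs0, hℓ0, hwh]
  have hev : (fun x => Jet.coord c (ε (σ.toFun (c.base.symm x)))) =ᶠ[𝓝 x₀]
      fun x => a.jetMap ε (ℓ (g.symm x)) := by
    filter_upwards [c.base.open_target.mem_nhds (c.fst_mem_target ht)] with x hx
    change Jet.coord c (ε (a.chart.symm (ℓ (g.symm (c.base (c.base.symm x)))))) = _
    rw [c.base.right_inv hx]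
    rfl
  have hd : HasFDerivAt (fun x => Jet.coord c (ε (σ.toFun (c.base.symm x))))
      (JetCoord.totalDeriv ζ') x₀ := by
    refine HasFDerivAt.congr_of_eventuallyEq ?_ hev
    rw [← ContinuousLinearMap.comp_id (JetCoord.totalDeriv ζ')]
    refine HasFDerivAt.comp x₀ (g := fun x => a.jetMap ε (ℓ x)) ?_ hgd
    rw [hgs0]
    exact hjd
  refine ⟨s.jet (k + 2) p hp, ⟨s, p, hp, rfl, σ, hpσ, ?_⟩, hjet⟩
  refine sameOneJet_of_fderiv_eq hp (c := c) hsrc (by rw [hσp]; exact hjet) ?_ ?_ ?_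
  · exact hε.smooth.1.continuousAt.comp
      (σ.contMDiffOn.contMDiffAt (σ.isOpen_domain.mem_nhds hpσ)).continuousAt
  · rw [hx0]; exact hd.differentiableAt
  · rw [(s.hasFDerivAt_prolongRep (k + 1) (s.contDiffAt_rep hp hsrc)).fderiv, hx0, hd.fderiv, hrep]

theorem mem_image_iff_isHolonomicPlane {a : AdaptedChart Z H} (hε : IsJetSection Z ε) {h : H}
    (hh : h ∈ a.chart.source) : ε h ∈ Jet.proj '' prolongation Z ε ↔
      IsHolonomicPlane (a.jetMap ε (a.chart h))
        (fderiv ℝ (a.jetMap ε) (a.chart h) ∘L a.slope ε (a.chart h)) :=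
  ⟨isHolonomicPlane_of_mem_image hε hh, mem_image_of_isHolonomicPlane hε hh⟩

end Curvature

/-! ### Solutions of ε(H) and integral sections of its plane field. -/

section Solutions

open Set Filter

variable {X Y Z : Type*} [NormedAddCommGroup X] [NormedSpace ℝ X] [FiniteDimensional ℝ X]
  [NormedAddCommGroup Y] [NormedSpace ℝ Y] [FiniteDimensional ℝ Y]
  [NormedAddCommGroup Z] [NormedSpace ℝ Z] [FiniteDimensional ℝ Z]
  {M E : Type*} [TopologicalSpace M] [ChartedSpace X M]
  [TopologicalSpace E] [ChartedSpace (X × Y) E] {π : E → M}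
  {k : ℕ} {H : Set (Jet X Y π k)} [ChartedSpace Z H] {ε : H → Jet X Y π (k + 1)}

/-- The prolongation `q ↦ j^k_q s` of a local section is continuous. -/
theorem LocalSection.continuousAt_jet (s : LocalSection X (X × Y) π) {f : M → Jet X Y π k}
    (hf : ∀ q (hq : q ∈ s.domain), f q = s.jet k q hq) {p : M} (hp : p ∈ s.domain) :
    ContinuousAt f p := by
  refine TopologicalSpace.tendsto_nhds_generateFrom_iff.2 ?_
  rintro _ ⟨c, O, hO, rfl⟩ ⟨h1, h2⟩
  rw [hf p hp] at h1 h2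
  have hc : s.toFun p ∈ c.total.source := h1
  rw [Jet.coord_jet s p hp hc] at h2
  have h3 : ContinuousAt (fun q => s.prolongRep c k (c.base q)) p :=
    (s.contDiffAt_prolongRep k hp hc).continuousAt.comp (c.base.continuousAt (s.base_mem hp hc))
  filter_upwards [s.eventually_mem hp hc, h3.preimage_mem_nhds (hO.mem_nhds h2)] with q hq hq'
  have h4 : (f q).target ∈ c.total.source ∧ Jet.coord c (f q) ∈ O := by
    rw [hf q hq.1]
    exact ⟨hq.2, by rw [Jet.coord_jet s q hq.1 hq.2]; exact hq'⟩
  exact h4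

theorem IsPDE.exists_adaptedChart [IsManifold 𝓘(ℝ, X × Y) ∞ E] [IsManifold 𝓘(ℝ, Z) ∞ H]
    (hπ : IsFibered X (X × Y) π) (hH : IsPDE Z H) (h : H) :
    ∃ a : AdaptedChart Z H, h ∈ a.chart.source := by
  obtain ⟨c, hc⟩ := hπ.exists_fiberedChart (h : Jet X Y π k).target
  obtain ⟨a, -, ha⟩ := hH.immersion.exists_adaptedChart h c hc
  exact ⟨a, ha⟩

/-- The prolongation of a solution of `ε(H)` is a local section of `ε(H) → M`. -/
theorem LocalSection.IsSolution.exists_lift [IsManifold 𝓘(ℝ, X × Y) ∞ E] [IsManifold 𝓘(ℝ, Z) ∞ H]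
    (hπ : IsFibered X (X × Y) π) (hH : IsPDE Z H) (hε : IsJetSection Z ε)
    {s : LocalSection X (X × Y) π} (hs : s.IsSolution (range ε)) (h₀ : H) :
    ∃ σ : LocalSection X Z (fun h : H => (h : Jet X Y π k).base), σ.domain = s.domain ∧
      ∀ q (hq : q ∈ s.domain), ε (σ.toFun q) = s.jet (k + 1) q hq := by
  classical
  choose F hF using hs
  -- The value `h₀` outside the domain is irrelevant.
  let f : M → H := fun q => if hq : q ∈ s.domain then F q hq else h₀
  have hf : ∀ q (hq : q ∈ s.domain), ε (f q) = s.jet (k + 1) q hq := fun q hq => by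
    simp only [f, dif_pos hq, hF]
  have hf' : ∀ q (hq : q ∈ s.domain), (f q : Jet X Y π k) = s.jet k q hq := fun q hq => by
    rw [← hε.proj_apply, hf q hq, Jet.proj_jet]
  -- H carries the subspace topology, so continuity can be tested in the space of jets.
  have hcont : ∀ p ∈ s.domain, ContinuousAt f p := fun p hp =>
    Topology.IsInducing.subtypeVal.continuousAt_iff.2 (s.continuousAt_jet hf' hp)
  refine ⟨⟨s.domain, s.isOpen_domain, f, fun p hp => ?_, fun p hp => ?_⟩, rfl, hf⟩
  · obtain ⟨a, ha⟩ := hH.exists_adaptedChart hπ (f p)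
    have ht : ∀ q ∈ s.domain, f q ∈ a.chart.source → s.toFun q ∈ a.fibered.total.source :=
      fun q hq hq' => by
        have := a.target_mem _ hq'
        rwa [hf' q hq, Jet.target_jet] at this
    have hval : ∀ q ∈ s.domain, f q ∈ a.chart.source →
        a.chart (f q) = a.lin (s.prolongRep a.fibered k (a.fibered.base q)) := fun q hq hq' => by
      rw [a.chart_apply _ hq', hf' q hq, Jet.coord_jet s q hq (ht q hq hq')]
    -- Continuity keeps `f` in the adapted chart near `p`, where its chart expression is a linear
    -- function of the prolonged section and therefore smooth.
    have hev : f =ᶠ[𝓝 p]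
        fun q => a.chart.symm (a.lin (s.prolongRep a.fibered k (a.fibered.base q))) := by
      filter_upwards [s.isOpen_domain.mem_nhds hp,
        (hcont p hp).preimage_mem_nhds (a.chart.open_source.mem_nhds ha)] with q hq hq'
      rw [← hval q hq hq', a.chart.left_inv hq']
    have hc := ht p hp ha
    have h1 : ContMDiffAt 𝓘(ℝ, X) 𝓘(ℝ, X) ∞ a.fibered.base p :=
      contMDiffAt_of_mem_maximalAtlas a.fibered.base_mem (s.base_mem hp hc)
    have h2 : ContMDiffAt 𝓘(ℝ, X) 𝓘(ℝ, Z) ∞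
        (fun x => a.lin (s.prolongRep a.fibered k x)) (a.fibered.base p) :=
      contMDiffAt_iff_contDiffAt.2
        (a.lin.contDiff.contDiffAt.comp _ (s.contDiffAt_prolongRep k hp hc))
    have h3 : ContMDiffAt 𝓘(ℝ, Z) 𝓘(ℝ, Z) ∞ a.chart.symm
        (a.lin (s.prolongRep a.fibered k (a.fibered.base p))) := by
      rw [← hval p hp ha]
      exact contMDiffAt_symm_of_mem_maximalAtlas a.chart_mem (a.chart.map_source ha)
    have h4 : ContMDiffAt 𝓘(ℝ, X) 𝓘(ℝ, Z) ∞
        (fun q => a.lin (s.prolongRep a.fibered k (a.fibered.base q))) p := h2.comp p h1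
    exact ((h3.comp p h4).congr_of_eventuallyEq hev).contMDiffWithinAt
  · rw [hf' p hp, Jet.base_jet]

theorem sameOneJet_of_jet_eq {m : ℕ} {s : LocalSection X (X × Y) π} {f : M → Jet X Y π m}
    (hf : ∀ q (hq : q ∈ s.domain), f q = s.jet m q hq) {p : M} (hp : p ∈ s.domain) :
    SameOneJet s f p hp := by
  refine ⟨(hf p hp).symm, fun c hc => Filter.EventuallyEq.fderiv_eq ?_⟩
  filter_upwards [s.eventually_base_symm hp hc (s.eventually_mem hp hc),
    c.base.open_target.mem_nhds (c.base.map_source (s.base_mem hp hc))] with x hx hx'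
  rw [hf _ hx.1, Jet.coord_jet s _ hx.1 hx.2, c.base.right_inv hx']

/-- For a solution, j^{k+1}s is itself a section ε ∘ σ of ε(H), so its 1-jets show that j^{k+2}s is
in the prolongation. Only existence of solutions is used. -/
theorem HasUniqueLocalSolutions.surjOn [IsManifold 𝓘(ℝ, X × Y) ∞ E] [IsManifold 𝓘(ℝ, Z) ∞ H]
    (hπ : IsFibered X (X × Y) π) (hH : IsPDE Z H) (hε : IsJetSection Z ε)
    (hu : HasUniqueLocalSolutions (range ε)) :
    SurjOn Jet.proj (prolongation Z ε) (range ε) := by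
  rintro _ ⟨h, rfl⟩
  obtain ⟨⟨s, hs, hsol, hjet⟩, -⟩ := hu (ε h) ⟨h, rfl⟩
  obtain ⟨σ, hσd, hσ⟩ := hsol.exists_lift hπ hH hε h
  exact ⟨s.jet (k + 2) _ hs, ⟨s, _, hs, rfl, σ, hσd ▸ hs, sameOneJet_of_jet_eq hσ hs⟩, hjet⟩

theorem isHolonomicPlane_of_surjOn {a : AdaptedChart Z H} (hε : IsJetSection Z ε)
    (hsurj : SurjOn Jet.proj (prolongation Z ε) (range ε)) {w : Z} (hw : w ∈ a.chart.target) :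
    IsHolonomicPlane (a.jetMap ε w) (fderiv ℝ (a.jetMap ε) w ∘L a.slope ε w) := by
  have := isHolonomicPlane_of_mem_image hε (a.chart.map_target hw) (hsurj ⟨a.chart.symm w, rfl⟩)
  rwa [a.chart.right_inv hw] at this

/-- Two solutions with the same initial condition agree. -/
theorem LocalSection.IsSolution.eventuallyEq [IsManifold 𝓘(ℝ, X × Y) ∞ E]
    [IsManifold 𝓘(ℝ, Z) ∞ H] (hπ : IsFibered X (X × Y) π) (hH : IsPDE Z H) (hε : IsJetSection Z ε)
    {s t : LocalSection X (X × Y) π} (hs : s.IsSolution (range ε)) (ht : t.IsSolution (range ε))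
    {p : M} (hps : p ∈ s.domain) (hpt : p ∈ t.domain)
    (hst : s.jet (k + 1) p hps = t.jet (k + 1) p hpt) : s.toFun =ᶠ[𝓝 p] t.toFun := by
  obtain ⟨h, hh⟩ := hs p hps
  obtain ⟨a, ha⟩ := hH.exists_adaptedChart hπ h
  obtain ⟨σ, hσd, hσ⟩ := hs.exists_lift hπ hH hε h
  obtain ⟨τ, hτd, hτ⟩ := ht.exists_lift hπ hH hε h
  have hσp : σ.toFun p = h := hε.injective (by rw [hσ p hps, hh])
  have hτp : τ.toFun p = h := hε.injective (by rw [hτ p hpt, ← hst, hh])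
  have hc : s.toFun p ∈ a.fibered.total.source := by
    have := a.target_mem h ha
    rwa [← hε.target_eq, hh, Jet.target_jet] at this
  have hb := s.base_mem hps hc
  have hev : ∀ {u : LocalSection X (X × Y) π}
      {υ : LocalSection X Z (fun h : H => (h : Jet X Y π k).base)}, p ∈ u.domain →
      υ.domain = u.domain → υ.toFun p = h →
      ∀ᶠ q in 𝓝 p, q ∈ u.domain ∧ υ.toFun q ∈ a.chart.source := by
    intro u υ hu hυ hυp
    refine Filter.inter_mem (u.isOpen_domain.mem_nhds hu) ?_
    exact (υ.contMDiffOn.contMDiffAt (υ.isOpen_domain.mem_nhds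
      (hυ ▸ hu))).continuousAt.preimage_mem_nhds (a.chart.open_source.mem_nhds (hυp ▸ ha))
  -- The lift of any solution is integral for the plane field at every point near `p`. No
  -- prolongability assumption enters.
  have hode : ∀ {u : LocalSection X (X × Y) π}
      {υ : LocalSection X Z (fun h : H => (h : Jet X Y π k).base)}, p ∈ u.domain →
      υ.domain = u.domain → υ.toFun p = h →
      (∀ q (hq : q ∈ u.domain), ε (υ.toFun q) = u.jet (k + 1) q hq) →
      ∀ᶠ x in 𝓝 (a.fibered.base p), HasFDerivAt (a.rep υ) (a.slope ε (a.rep υ x)) x := by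
    intro u υ hu hυ hυp hυj
    filter_upwards [(a.fibered.base.tendsto_symm hb).eventually (hev hu hυ hυp),
      a.fibered.base.open_target.mem_nhds (a.fibered.base.map_source hb)] with x hx hx'
    have h1 := ((sameOneJet_of_jet_eq hυj hx.1).hasFDerivAt_rep hε (hυ ▸ hx.1) hx.2).1
    rw [a.fibered.base.right_inv hx'] at h1
    exact h1
  have hrep0 : ∀ {υ : LocalSection X Z (fun h : H => (h : Jet X Y π k).base)}, υ.toFun p = h →
      a.rep υ (a.fibered.base p) = a.chart h := by
    intro υ hυp
    rw [AdaptedChart.rep, a.fibered.base.left_inv hb, hυp]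
  have heq : a.rep σ =ᶠ[𝓝 (a.fibered.base p)] a.rep τ := by
    refine eventuallyEq_of_hasFDerivAt ?_ (hode hps hσd hσp hσ) (hode hpt hτd hτp hτ)
      ((hrep0 hσp).trans (hrep0 hτp).symm)
    rw [hrep0 hσp]
    exact ((AdaptedChart.contDiffOn_slope hε).contDiffAt
      (a.chart.open_target.mem_nhds (a.chart.map_source ha))).of_le (by simp)
  filter_upwards [hev hps hσd hσp, hev hpt hτd hτp, a.fibered.base.open_source.mem_nhds hb,
    (a.fibered.base.continuousAt hb).eventually heq] with q h1 h2 h3 h4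
  simp only [AdaptedChart.rep, a.fibered.base.left_inv h3] at h4
  have h5 : s.jet (k + 1) q h1.1 = t.jet (k + 1) q h2.1 := by
    rw [← hσ, ← hτ, a.chart.injOn h1.2 h2.2 h4]
  exact congrArg Jet.target h5

/-- If all jets in `ε(H)` can be prolonged, there are solutions through all of them. -/
theorem exists_solution_of_surjOn [IsManifold 𝓘(ℝ, X × Y) ∞ E] [IsManifold 𝓘(ℝ, Z) ∞ H]
    (hπ : IsFibered X (X × Y) π) (hH : IsPDE Z H) (hε : IsJetSection Z ε)
    (hsurj : SurjOn Jet.proj (prolongation Z ε) (range ε)) (h : H) :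
    ∃ (s : LocalSection X (X × Y) π) (hs : (ε h).base ∈ s.domain),
      s.IsSolution (range ε) ∧ s.jet (k + 1) (ε h).base hs = ε h := by
  have : CompleteSpace Y := FiniteDimensional.complete ℝ Y
  have : CompleteSpace Z := FiniteDimensional.complete ℝ Z
  obtain ⟨a, ha⟩ := hH.exists_adaptedChart hπ h
  have hhol := fun {w} (hw : w ∈ a.chart.target) => isHolonomicPlane_of_surjOn hε hsurj hw
  have hw₀ := a.chart.map_source ha
  -- The initial point is the base coordinate of ε(h), so that σ can turn out to cover the identity.
  obtain ⟨r, hr, σ, hσ₀, hσ⟩ := exists_hasFDerivAt_of_involutive (X := X) a.chart.open_target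
    (AdaptedChart.contDiffOn_slope hε)
    (fun w hw => AdaptedChart.fderiv_slope_symm hε hw (hhol hw))
    (a.jetMap ε (a.chart h)).1 hw₀
  set x₀ := (a.jetMap ε (a.chart h)).1 with hx₀
  set U := Metric.ball x₀ r with hU
  have hUo : IsOpen U := Metric.isOpen_ball
  have hxU : x₀ ∈ U := Metric.mem_ball_self hr
  set f : X → JetCoord X Y (k + 1) := fun x => a.jetMap ε (σ x) with hf
  have hσs : ContDiffOn ℝ ∞ σ U :=
    contDiffOn_of_hasFDerivAt (AdaptedChart.contDiffOn_slope hε) hUo hσ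
  have hfs : ContDiffOn ℝ ∞ f U :=
    (AdaptedChart.contDiffOn_jetMap hε).comp hσs fun x hx => (hσ x hx).1
  -- Prolongability at each point of the chart, not only at `h`: the derivative of ε ∘ σ is
  -- everywhere the plane of a jet over its value.
  have hfd : ∀ x ∈ U, ∃ ζ' : JetCoord X Y (k + 2),
      JetCoord.truncate X Y (k + 1) ζ' = f x ∧ HasFDerivAt f (JetCoord.totalDeriv ζ') x := by
    intro x hx
    obtain ⟨ζ', -, htr, hB⟩ := hhol (hσ x hx).1
    exact ⟨ζ', htr, hB ▸ (AdaptedChart.hasFDerivAt_jetMap hε (hσ x hx).1).comp x (hσ x hx).2⟩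
  -- That the jet at parameter `x` lies over `x` is not part of the differential equation. It
  -- follows because the base coordinate has derivative the identity on the ball and the right value
  -- at the centre.
  have hfst : ∀ x ∈ U, (f x).1 = x := by
    have hd : ∀ x ∈ U, HasFDerivAt (fun x => (f x).1 - x) (0 : X →L[ℝ] X) x := by
      intro x hx
      obtain ⟨ζ', -, h1⟩ := hfd x hx
      have h2 : HasFDerivAt (fun x => (f x).1) (ContinuousLinearMap.id ℝ X) x := h1.fst
      have h3 := h2.sub (hasFDerivAt_id x)
      rw [sub_self] at h3
      exact h3
    intro x hx
    have h1 := hUo.is_const_of_fderiv_eq_zero (convex_ball x₀ r).isPreconnected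
      (fun x hx => (hd x hx).differentiableAt.differentiableWithinAt)
      (fun x hx => (hd x hx).fderiv) hx hxU
    have h2 : (f x₀).1 - x₀ = 0 := by
      rw [hf]
      simp only [hσ₀]
      exact sub_self _
    exact sub_eq_zero.1 (h1.trans h2)
  have hfj : ∀ x ∈ U, ∀ j : Fin (k + 1),
      HasFDerivAt (fun x => (f x).2 j.castSucc) (curryFirst X Y j ((f x).2 j.succ)) x := by
    intro x hx j
    obtain ⟨ζ', htr, h1⟩ := hfd x hx
    rw [← htr]
    exact hasFDerivAt_pi'.1 h1.snd j.castSucc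
  have hit := iteratedFDeriv_of_holonomic hUo hfj
  set y : X → Y := fun x => (f x).2 0 fun i => i.elim0 with hy
  have hfc : ∀ x ∈ U, (ε (a.chart.symm (σ x))).target ∈ a.fibered.total.source := fun x hx =>
    AdaptedChart.target_mem_symm hε (hσ x hx).1
  have hxy : ∀ x ∈ U, (f x).toTotal = (x, y x) := fun x hx => Prod.ext (hfst x hx) rfl
  have hmem : ∀ x ∈ U, (x, y x) ∈ a.fibered.total.target := fun x hx => by
    rw [← hxy x hx]
    exact Jet.toTotal_mem (hfc x hx)
  have hys : ContDiffOn ℝ ∞ y U := by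
    have h1 : ContDiffOn ℝ ∞ (fun x => (f x).2 0) U :=
      contDiffOn_pi.1 (contDiff_snd.comp_contDiffOn hfs) 0
    exact (ContinuousMultilinearMap.apply ℝ (fun _ : Fin ((0 : Fin (k + 2)) : ℕ) => X) Y
      fun i => i.elim0).contDiff.comp_contDiffOn h1
  set s := a.fibered.toSection y hUo hys hmem with hsdef
  -- By `hit` the components of `f` are the derivatives of `y`, so the jets of the section with
  -- expression `y` have the same coordinates as those of ε.
  have hjet : ∀ q (hq : q ∈ s.domain),
      s.jet (k + 1) q hq = ε (a.chart.symm (σ (a.fibered.base q))) := by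
    rintro q ⟨hq, hqU⟩
    have hxU' : a.fibered.base q ∈ U := hqU
    have hsrc := FiberedChart.toSection_mem_source (hy := hys) (hU := hUo) (hmem := hmem) hxU'
    rw [a.fibered.base.left_inv hq] at hsrc
    refine Jet.ext_coord hsrc (hfc _ hxU') ?_
    rw [Jet.coord_jet s q ⟨hq, hqU⟩ hsrc, hsdef, FiberedChart.toSection_prolongRep (k + 1) hxU']
    exact Prod.ext (hfst _ hxU').symm (funext fun j => hit j j.2 _ hxU')
  have hh : (ε h).target ∈ a.fibered.total.source := by
    rw [hε.target_eq]; exact a.target_mem h ha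
  have hbase : a.fibered.base (ε h).base = x₀ := by
    rw [← Jet.coord_fst hh, hx₀, AdaptedChart.jetMap_chart ha]
  have hdom : (ε h).base ∈ s.domain := ⟨Jet.base_mem hh, by rw [mem_preimage, hbase]; exact hxU⟩
  refine ⟨s, hdom, fun q hq => ⟨_, (hjet q hq).symm⟩, ?_⟩
  rw [hjet, hbase, hσ₀, a.chart.left_inv ha]

theorem hasUniqueLocalSolutions_iff_surjOn [IsManifold 𝓘(ℝ, X × Y) ∞ E] [IsManifold 𝓘(ℝ, Z) ∞ H]
    (hπ : IsFibered X (X × Y) π) (hH : IsPDE Z H) (hε : IsJetSection Z ε) :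
    HasUniqueLocalSolutions (range ε) ↔ SurjOn Jet.proj (prolongation Z ε) (range ε) := by
  refine ⟨fun h => h.surjOn hπ hH hε, fun hsurj => ?_⟩
  rintro _ ⟨h, rfl⟩
  exact ⟨exists_solution_of_surjOn hπ hH hε hsurj h, fun s t hs ht hsol htol hsj htj =>
    hsol.eventuallyEq hπ hH hε htol hs ht (hsj.trans htj.symm)⟩

end Solutions

/-! ### Prolongability as the vanishing of a smooth function. -/

/-- A smooth function which vanishes at the origin only. -/
theorem exists_contDiff_eq_zero_iff (V : Type*) [NormedAddCommGroup V] [NormedSpace ℝ V]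
    [FiniteDimensional ℝ V] :
    ∃ N : V → ℝ, ContDiff ℝ ∞ N ∧ (∀ v, 0 ≤ N v) ∧ ∀ v, N v = 0 ↔ v = 0 :=
  -- The square of the given norm need not be smooth, hence the passage to a Euclidean norm.
  ⟨fun v => ‖toEuclidean v‖ ^ 2, toEuclidean.contDiff.norm_sq ℝ, fun v => by positivity,
    fun v => by simp⟩

section HolonomyDefect

open Set Filter

variable {X Y : Type*} [NormedAddCommGroup X] [NormedSpace ℝ X] [FiniteDimensional ℝ X]
  [NormedAddCommGroup Y] [NormedSpace ℝ Y] [FiniteDimensional ℝ Y] {k : ℕ}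

/-- The components of highest order of a linear map to the space of jet coordinates, as a
multilinear map. -/
def topComponent (B : X →L[ℝ] JetCoord X Y (k + 1)) : X [×(k + 2)]→L[ℝ] Y :=
  (curryFirst X Y (k + 1)).symm
    ((ContinuousLinearMap.proj (R := ℝ) (φ := fun j : Fin (k + 2) => X [×(j : ℕ)]→L[ℝ] Y)
      (Fin.last (k + 1))).comp ((ContinuousLinearMap.snd ℝ X _).comp B))

/-- The space of values of the curvature in jet coordinates. -/
abbrev DefectSpace (X Y : Type*) [NormedAddCommGroup X] [NormedSpace ℝ X]
    [NormedAddCommGroup Y] [NormedSpace ℝ Y] (k : ℕ) : Type _ :=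
  (X →L[ℝ] JetCoord X Y k) × (Equiv.Perm (Fin (k + 2)) → X [×(k + 2)]→L[ℝ] Y)

instance instFiniteDimensionalDefectSpace (k : ℕ) : FiniteDimensional ℝ (DefectSpace X Y k) := by
  have h1 : FiniteDimensional ℝ (X →L[ℝ] JetCoord X Y k) := inferInstance
  have h2 : FiniteDimensional ℝ (X [×(k + 2)]→L[ℝ] Y) :=
    finiteDimensional_continuousMultilinearMap X Y (k + 2)
  have h3 : FiniteDimensional ℝ (Equiv.Perm (Fin (k + 2)) → X [×(k + 2)]→L[ℝ] Y) :=
    Module.Finite.pi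
  exact Module.Finite.prod

/-- The obstruction for `B` to come from jet coordinates of one order more: the difference of `B` and
the plane determined by `ζ` in the lower orders, and the failure of the components of highest order
to be symmetric. -/
def holonomyDefect (ζ : JetCoord X Y (k + 1)) (B : X →L[ℝ] JetCoord X Y (k + 1)) :
    DefectSpace X Y k :=
  (JetCoord.truncate X Y k ∘L B - JetCoord.totalDeriv ζ,
    fun σ => (topComponent B).domDomCongr σ - topComponent B)

/-- Only the derivatives of highest order of ζ' are not already fixed by ζ, and `B` prescribes them
through its top components. The two parts of the defect say that the remaining components of `B`
agree with ζ and that the prescribed ones are symmetric. -/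
theorem isHolonomicPlane_iff_holonomyDefect {ζ : JetCoord X Y (k + 1)}
    (hζ : ∀ j, IsSymmetric (ζ.2 j)) {B : X →L[ℝ] JetCoord X Y (k + 1)} :
    IsHolonomicPlane ζ B ↔ holonomyDefect ζ B = 0 := by
  constructor
  · rintro ⟨ζ', hsym, rfl, rfl⟩
    refine Prod.ext ?_ (funext fun σ => ?_)
    · exact sub_eq_zero.2 (JetCoord.truncate_comp_totalDeriv ζ')
    · have h1 : topComponent (JetCoord.totalDeriv ζ') = ζ'.2 (Fin.last (k + 2)) :=
        (curryFirst X Y (k + 1)).symm_apply_apply _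
      refine sub_eq_zero.2 ?_
      rw [h1]
      ext v
      exact hsym (Fin.last (k + 2)) σ v
  · intro h
    have h1 : JetCoord.truncate X Y k ∘L B = JetCoord.totalDeriv ζ :=
      sub_eq_zero.1 (congrArg Prod.fst h)
    have h2 : IsSymmetric (topComponent B) := fun σ v =>
      DFunLike.congr_fun (sub_eq_zero.1 (congrFun (congrArg Prod.snd h) σ)) v
    -- The only possible candidate: ζ extended by the top component of `B`.
    let ζ' : JetCoord X Y (k + 2) := (ζ.1,
      Fin.snoc (α := fun j : Fin (k + 3) => X [×(j : ℕ)]→L[ℝ] Y) ζ.2 (topComponent B))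
    have hcast : ∀ j : Fin (k + 2), ζ'.2 j.castSucc = ζ.2 j := fun j =>
      Fin.snoc_castSucc (α := fun j : Fin (k + 3) => X [×(j : ℕ)]→L[ℝ] Y) (topComponent B) ζ.2 j
    have hlast : ζ'.2 (Fin.last (k + 2)) = topComponent B :=
      Fin.snoc_last (α := fun j : Fin (k + 3) => X [×(j : ℕ)]→L[ℝ] Y) (topComponent B) ζ.2
    refine ⟨ζ', fun j => ?_, Prod.ext rfl (funext hcast), ?_⟩
    · induction j using Fin.lastCases with
      | last => rw [hlast]; exact h2
      | cast j => rw [hcast]; exact hζ j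
    · ext v : 1
      have hv : JetCoord.truncate X Y k (B v) = JetCoord.totalDeriv ζ v := DFunLike.congr_fun h1 v
      have hv1 : (B v).1 = v := congrArg Prod.fst hv
      refine Prod.ext hv1 (funext fun j => ?_)
      rw [JetCoord.totalDeriv_apply_snd]
      induction j using Fin.lastCases with
      | last =>
        have h3 : curryFirst X Y (k + 1) (topComponent B) v = (B v).2 (Fin.last (k + 1)) :=
          DFunLike.congr_fun ((curryFirst X Y (k + 1)).apply_symm_apply _) v
        rw [← h3, ← hlast]
        rfl
      | cast j =>
        have h3 : (B v).2 j.castSucc = curryFirst X Y j (ζ.2 j.succ) v :=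
          congrFun (congrArg Prod.snd hv) j
        rw [h3, ← hcast]
        rfl

theorem contDiff_topComponent :
    ContDiff ℝ ∞ (topComponent : (X →L[ℝ] JetCoord X Y (k + 1)) → _) :=
  (contDiff_curryFirst_symm (k + 1)).comp
    (contDiff_const.clm_comp (contDiff_const.clm_comp contDiff_id))

theorem contDiff_holonomyDefect :
    ContDiff ℝ ∞ (fun q : JetCoord X Y (k + 1) × (X →L[ℝ] JetCoord X Y (k + 1)) =>
      holonomyDefect q.1 q.2) := by
  refine ContDiff.prodMk ?_ (contDiff_pi.2 fun σ => ?_)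
  · exact (contDiff_const.clm_comp contDiff_snd).sub
      ((JetCoord.contDiff_totalDeriv k).comp contDiff_fst)
  · have h1 : ContDiff ℝ ∞ (fun q : JetCoord X Y (k + 1) × (X →L[ℝ] JetCoord X Y (k + 1)) =>
        topComponent q.2) := contDiff_topComponent.comp contDiff_snd
    exact ((ContinuousMultilinearMap.domDomCongrₗᵢ ℝ X Y σ).contDiff.comp h1).sub h1

end HolonomyDefect

/-! ### The global curvature function. -/

section Curvature

open Set Filter

variable {X Y Z : Type*} [NormedAddCommGroup X] [NormedSpace ℝ X] [FiniteDimensional ℝ X]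
  [NormedAddCommGroup Y] [NormedSpace ℝ Y] [FiniteDimensional ℝ Y]
  [NormedAddCommGroup Z] [NormedSpace ℝ Z] [FiniteDimensional ℝ Z]
  {M E : Type*} [TopologicalSpace M] [ChartedSpace X M]
  [TopologicalSpace E] [ChartedSpace (X × Y) E] {π : E → M}
  {k : ℕ} {H : Set (Jet X Y π k)} [ChartedSpace Z H] {ε : H → Jet X Y π (k + 1)}

/-- The curvature of `ε` in an adapted chart of `H`: the obstruction to prolong `ε(h)`. -/
def AdaptedChart.curvature (a : AdaptedChart Z H) (ε : H → Jet X Y π (k + 1)) (w : Z) :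
    DefectSpace X Y k :=
  holonomyDefect (a.jetMap ε w) (fderiv ℝ (a.jetMap ε) w ∘L a.slope ε w)

theorem AdaptedChart.contDiffOn_curvature {a : AdaptedChart Z H} (hε : IsJetSection Z ε) :
    ContDiffOn ℝ ∞ (a.curvature ε) a.chart.target := by
  have h1 := contDiffOn_jetMap (a := a) hε
  have h2 : ContDiffOn ℝ ∞ (fderiv ℝ (a.jetMap ε)) a.chart.target :=
    h1.fderiv_of_isOpen a.chart.open_target (by simp)
  have h3 : ContDiffOn ℝ ∞ (fun w => fderiv ℝ (a.jetMap ε) w ∘L a.slope ε w) a.chart.target :=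
    h2.clm_comp (contDiffOn_slope hε)
  exact ContDiff.comp_contDiffOn (𝕜 := ℝ) (E := Z)
    (F := JetCoord X Y (k + 1) × (X →L[ℝ] JetCoord X Y (k + 1))) (G := DefectSpace X Y k)
    (f := fun w => (a.jetMap ε w, fderiv ℝ (a.jetMap ε) w ∘L a.slope ε w))
    contDiff_holonomyDefect (h1.prodMk h3)

/-- The condition on the right does not involve the chart, so all local curvatures have the same
zeros where they are defined; this makes gluing possible. -/
theorem AdaptedChart.curvature_eq_zero_iff {a : AdaptedChart Z H} (hε : IsJetSection Z ε) {h : H}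
    (hh : h ∈ a.chart.source) :
    a.curvature ε (a.chart h) = 0 ↔ ε h ∈ Jet.proj '' prolongation Z ε := by
  rw [mem_image_iff_isHolonomicPlane hε hh, isHolonomicPlane_iff_holonomyDefect, curvature]
  intro j
  exact Jet.isSymmetric_coord (target_mem_symm hε (a.chart.map_source hh)) j

/-- The curvature of `ε`: the squared norms of its local curvatures in adapted charts, glued by a partition of unity. -/
theorem exists_curvature [T2Space E] [SecondCountableTopology E] [IsManifold 𝓘(ℝ, X × Y) ∞ E]
    [IsManifold 𝓘(ℝ, Z) ∞ H] (hπ : IsFibered X (X × Y) π) (hH : IsPDE Z H)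
    (hε : IsJetSection Z ε) :
    ∃ R : C^∞⟮𝓘(ℝ, Z), H; 𝓘(ℝ, ℝ), ℝ⟯, ∀ h, R h = 0 ↔ ε h ∈ Jet.proj '' prolongation Z ε := by
  classical
  have : T2Space (Jet X Y π k) := Jet.t2Space hπ
  have : SecondCountableTopology (Jet X Y π k) := Jet.secondCountableTopology hπ
  have : LocallyCompactSpace H := ChartedSpace.locallyCompactSpace Z H
  obtain ⟨N, hN, hN', hN0⟩ := exists_contDiff_eq_zero_iff (DefectSpace X Y k)
  -- Gluing by a partition of unity preserves convex conditions. Being nonzero in a vector space is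
  -- not convex in general, but being positive is; this is the reason for passing to real values
  -- through `N`.
  let t : H → Set ℝ := fun h => if ε h ∈ Jet.proj '' prolongation Z ε then {0} else Ioi 0
  have ht : ∀ h, Convex ℝ (t h) := fun h => by
    by_cases hh : ε h ∈ Jet.proj '' prolongation Z ε
    · simp only [t, if_pos hh]; exact convex_singleton 0
    · simp only [t, if_neg hh]; exact convex_Ioi 0
  obtain ⟨R, hR⟩ := exists_contMDiffMap_forall_mem_convex_of_local (n := (⊤ : ℕ∞)) 𝓘(ℝ, Z) ht fun h => by
    obtain ⟨a, ha⟩ := hH.exists_adaptedChart hπ h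
    refine ⟨a.chart.source, a.chart.open_source.mem_nhds ha,
      fun h => N (a.curvature ε (a.chart h)), ?_, fun h hh => ?_⟩
    · have h1 : ContDiffOn ℝ ∞ (fun w => N (a.curvature ε w)) a.chart.target :=
        hN.comp_contDiffOn (AdaptedChart.contDiffOn_curvature hε)
      exact (contMDiffOn_iff_contDiffOn.2 h1).comp (contMDiffOn_of_mem_maximalAtlas a.chart_mem)
        a.chart.mapsTo
    · have h1 := (hN0 _).trans (AdaptedChart.curvature_eq_zero_iff hε hh)
      by_cases hz : ε h ∈ Jet.proj '' prolongation Z ε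
      · simp only [t, if_pos hz, mem_singleton_iff]
        exact h1.2 hz
      · simp only [t, if_neg hz, mem_Ioi]
        exact (hN' _).lt_of_ne fun h0 => hz (h1.1 h0.symm)
  refine ⟨R, fun h => ?_⟩
  have h1 := hR h
  by_cases hh : ε h ∈ Jet.proj '' prolongation Z ε
  · simp only [t, if_pos hh, mem_singleton_iff] at h1
    exact iff_of_true h1 hh
  · simp only [t, if_neg hh, mem_Ioi] at h1
    exact iff_of_false h1.ne' hh

/-- Equality of values in `SameOneJet` already places j^{k+1}s in the image of ε. -/
theorem image_proj_prolongation_subset :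
    Jet.proj '' prolongation Z ε ⊆ range ε := by
  rintro _ ⟨_, ⟨s, p, hp, rfl, σ, -, hσ, -⟩, rfl⟩
  exact ⟨σ.toFun p, by rw [Jet.proj_jet]; exact hσ.symm⟩

end Curvature

end JetGeometry

end

/-! ### The main theorem. -/

theorem proposition10 {X Y Z : Type*}
    [NormedAddCommGroup X] [NormedSpace ℝ X] [FiniteDimensional ℝ X]
    [NormedAddCommGroup Y] [NormedSpace ℝ Y] [FiniteDimensional ℝ Y]
    [NormedAddCommGroup Z] [NormedSpace ℝ Z] [FiniteDimensional ℝ Z]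
    {M : Type*} [TopologicalSpace M] [ChartedSpace X M] [IsManifold 𝓘(ℝ, X) ∞ M]
    [T2Space M] [SecondCountableTopology M]
    {E : Type*} [TopologicalSpace E] [ChartedSpace (X × Y) E] [IsManifold 𝓘(ℝ, X × Y) ∞ E]
    [T2Space E] [SecondCountableTopology E]
    (π : E → M) (hπ : JetGeometry.IsFibered X (X × Y) π)
    (k : ℕ) (H : Set (JetGeometry.Jet X Y π k)) [ChartedSpace Z H] [IsManifold 𝓘(ℝ, Z) ∞ H]
    (hH : JetGeometry.IsPDE Z H)
    (ε : H → JetGeometry.Jet X Y π (k + 1)) (hε : JetGeometry.IsJetSection Z ε) :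
    (JetGeometry.HasUniqueLocalSolutions (Set.range ε) ↔
      Set.SurjOn JetGeometry.Jet.proj (JetGeometry.prolongation Z ε) (Set.range ε)) ∧
    ∃ (F : Type) (_ : NormedAddCommGroup F) (_ : NormedSpace ℝ F) (_ : FiniteDimensional ℝ F)
      (V : H → Type) (_ : ∀ h, TopologicalSpace (V h)) (_ : ∀ h, AddCommGroup (V h))
      (_ : ∀ h, Module ℝ (V h)) (_ : TopologicalSpace (Bundle.TotalSpace F V))
      (_ : FiberBundle F V) (_ : VectorBundle ℝ F V)
      (_ : ContMDiffVectorBundle ∞ F V 𝓘(ℝ, Z))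
      (R : ContMDiffSection 𝓘(ℝ, Z) F ∞ V),
      JetGeometry.Jet.proj '' JetGeometry.prolongation Z ε = ε '' {h | R h = 0} ∧
      ((∀ h, R h = 0) ↔
        Set.SurjOn JetGeometry.Jet.proj (JetGeometry.prolongation Z ε) (Set.range ε)) := by
  refine ⟨JetGeometry.hasUniqueLocalSolutions_iff_surjOn hπ hH hε, ?_⟩
  obtain ⟨R, hR⟩ := JetGeometry.exists_curvature hπ hH hε
  -- F₁ is the trivial real line bundle on H, whose smooth sections are smooth functions.
  refine ⟨ℝ, inferInstance, inferInstance, inferInstance, Bundle.Trivial H ℝ, inferInstance,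
    inferInstance, inferInstance, inferInstance, inferInstance, inferInstance, inferInstance,
    ⟨R, fun h => Bundle.contMDiffAt_section h |>.2 (R.contMDiff h)⟩, ?_, ?_⟩
  · refine Set.Subset.antisymm (fun r hr => ?_) ?_
    · obtain ⟨h, rfl⟩ := JetGeometry.image_proj_prolongation_subset hr
      exact ⟨h, (hR h).2 hr, rfl⟩
    · rintro _ ⟨h, hh, rfl⟩
      exact (hR h).1 hh
  · refine ⟨fun h0 => ?_, fun hs h => (hR h).2 (hs ⟨h, rfl⟩)⟩
    rintro _ ⟨h, rfl⟩
    exact (hR h).1 (h0 h)
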